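/- Let $L>0$ and let $k\in L^2((0,L)\times(0,L))$ be a real kernel. Consider the integral transport equation $$ \begin{cases} y_t(t,x)-y_x(t,x)=\displaystyle\int_0^L k(x,\xi)\,y(t,\xi)\,d\xi, & t\in(0,T),\ x\in(0,L),\\ y(t,L)=u(t), & t\in(0,T),\\ y(0,x)=y^0(x), & x\in(0,L), \end{cases} $$ with state $y(t,\cdot)$ in the real space $L^2(0,L)$ and control $u\in L^2(0,T)$ (real-valued). In abstract form it reads $y'=A_{\mathcal K}y+Bu$, where $$ A_{\mathcal K}y=y_x+\int_0^Lk(\cdot,\xi)y(\xi)\,d\xi,\qquad D(A_{\mathcal K})=\{y\in H^1(0,L):\ y(L)=0\}, $$ and $B$ is given by $\langle Bu,z\rangle=u\,z(L)$ for $z\in D(A_{\mathcal K}^*)\subset H^1(0,L)$, i.e. $B^*z=z(L)$. The solution is understood by transposition: $y\in C^0([0,T];L^2(0,L))$ and, for every $\tau\in[0,T]$ and every $z\in C^1([0,\tau];L^2(0,L))\cap C^0([0,\tau];D(A_{\mathcal K}^*))$ with $z'=-A_{\mathcal K}^*z$ on $[0,\tau]$, $$ \langle y(\tau),z(\tau)\rangle-\langle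 y^0,z(0)\rangle=\int_0^\tau u(t)\,B^*z(t)\,dt . $$ The equation is exactly controllable in time $T$ if for all $y^0,y^1\in L^2(0,L)$ there is $u\in L^2(0,T)$ such that the solution satisfies $y(T)=y^1$; it is approximately controllable in time $T$ if for every $\varepsilon>0$ and all $y^0,y^1\in L^2(0,L)$ there is $u\in L^2(0,T)$ such that the solution satisfies $\|y(T)-y^1\|_{L^2(0,L)}\le\varepsilon$. Then: (i) The equation is exactly controllable in time $T=L$ if and only if it is approximately controllable in time $T=L$. (ii) For every $T>L$, the equation is exactly controllable in time $T$ if and only if the Fattorini criterion $$ \ker(\lambda-A_{\mathcal K}^*)\cap\ker B^*=\{0\}\qquad\text{for all }\lambda\in\mathbb C $$ holds, where $A_{\mathcal K}$ and $B$ denote here the complexified operators, acting on $L^2(0,L;\mathbb C)$ (same formulas). In particular, the equation is exactly controllable in every time $T>L$ if and only if the Fattorini criterion holds. -/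

import Mathlib

open MeasureTheory Set
open scoped ContDiff LinearPMap

/-! ## Abstract controlled linear systems

A control system `y' = A y + B u` on a Hilbert space `H` with control space `U` is described by the
unbounded operator `A : H →ₗ.[𝕜] H` and by the adjoint `Bs : D(A*) → U` of the control operator
`B ∈ L(U, D(A*)')`, that is, `⟨B u, z⟩ = ⟨u, Bs z⟩` for `z ∈ D(A*)`. -/

section AbstractControl

variable {𝕜 H U : Type*} [RCLike 𝕜]
  [NormedAddCommGroup H] [InnerProductSpace 𝕜 H] [NormedSpace ℝ H] [CompleteSpace H]
  [NormedAddCommGroup U] [InnerProductSpace 𝕜 U]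

/-- `z` is a classical solution on `[0, τ]` of the backward adjoint equation `z' = -A* z`,
i.e. it lies in `C¹([0, τ]; H) ∩ C⁰([0, τ]; D(A*))` (equivalently,
`z t = S_A(τ - t)* z(τ)` with `z(τ) ∈ D(A*)`). -/
def IsAdjointSolution (A : H →ₗ.[𝕜] H) (τ : ℝ) (z : ℝ → A†.domain) : Prop :=
  (∀ t ∈ Icc 0 τ, HasDerivWithinAt (fun s => (z s : H)) (-(A† (z t))) (Icc 0 τ) t) ∧
    ContinuousOn (fun t => A† (z t)) (Icc 0 τ)

/-- `y ∈ C⁰([0, T]; H)` is the solution by transposition of `y' = A y + B u` on `(0, T)`,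
`y(0) = y₀`: for every `τ ∈ [0, T]` and every solution `z` of the backward adjoint equation on
`[0, τ]`, `⟨y(τ), z(τ)⟩ - ⟨y₀, z(0)⟩ = ∫₀^τ ⟨u(t), B* z(t)⟩ dt`.
(The Mathlib inner product is linear in its second argument.) -/
def IsTranspositionSolution (A : H →ₗ.[𝕜] H) (Bs : A†.domain → U) (T : ℝ) (y₀ : H)
    (u : ℝ → U) (y : ℝ → H) : Prop :=
  ContinuousOn y (Icc 0 T) ∧
    ∀ τ ∈ Icc 0 T, ∀ z : ℝ → A†.domain, IsAdjointSolution A τ z →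
      inner 𝕜 (z τ : H) (y τ) - inner 𝕜 (z 0 : H) y₀ = ∫ t in (0 : ℝ)..τ, inner 𝕜 (Bs (z t)) (u t)

/-- Exact controllability in time `T`, with controls in `L²(0, T; U)`. -/
def ExactlyControllable (A : H →ₗ.[𝕜] H) (Bs : A†.domain → U) (T : ℝ) : Prop :=
  ∀ y₀ y₁ : H, ∃ u : ℝ → U, MemLp u 2 (volume.restrict (Ioo 0 T)) ∧
    ∃ y : ℝ → H, IsTranspositionSolution A Bs T y₀ u y ∧ y T = y₁

/-- Approximate controllability in time `T`, with controls in `L²(0, T; U)`. -/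
def ApproximatelyControllable (A : H →ₗ.[𝕜] H) (Bs : A†.domain → U) (T : ℝ) : Prop :=
  ∀ ε : ℝ, 0 < ε → ∀ y₀ y₁ : H, ∃ u : ℝ → U, MemLp u 2 (volume.restrict (Ioo 0 T)) ∧
    ∃ y : ℝ → H, IsTranspositionSolution A Bs T y₀ u y ∧ ‖y T - y₁‖ ≤ ε

/-- The Fattorini criterion `ker (lam - A*) ∩ ker B* = {0}` for all scalars `lam`
(to be used over `ℂ`). -/
def FattoriniCriterion (A : H →ₗ.[𝕜] H) (Bs : A†.domain → U) : Prop :=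
  ∀ lam : 𝕜, ∀ z : A†.domain, A† z = lam • (z : H) → Bs z = 0 → z = 0

end AbstractControl

namespace IntegralTransport

noncomputable section

/-- Lebesgue measure on `(0, L)`. -/
abbrev μI (L : ℝ) : Measure ℝ := volume.restrict (Ioo 0 L)

/-- The space `L²(0, L; 𝕜)`. -/
abbrev L2 (𝕜 : Type*) [RCLike 𝕜] (L : ℝ) : Type _ := Lp 𝕜 2 (μI L)

variable {𝕜 : Type*} [RCLike 𝕜] {L : ℝ}

/-- `g ∈ L²(0, L)` is the weak derivative of `y ∈ L²(0, L)`. -/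
def HasWeakDeriv (y g : L2 𝕜 L) : Prop :=
  ∀ φ : ℝ → ℝ, ContDiff ℝ ∞ φ → HasCompactSupport φ → tsupport φ ⊆ Ioo 0 L →
    ∫ x in Ioo 0 L, deriv φ x • y x = -∫ x in Ioo 0 L, φ x • g x

/-- `y` has a representative that is continuous on `[0, L]` and takes the value `c` at `x`. -/
def HasTrace (y : L2 𝕜 L) (x : ℝ) (c : 𝕜) : Prop :=
  ∃ f : ℝ → 𝕜, ContinuousOn f (Icc 0 L) ∧ y =ᵐ[μI L] f ∧ f x = c

open Classical in
/-- The value at `x ∈ [0, L]` of the continuous representative of `y`, for instance for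
`y ∈ H¹(0, L)` (and `0` by convention if `y` has no continuous representative). -/
def trace (y : L2 𝕜 L) (x : ℝ) : 𝕜 :=
  if h : ∃ c, HasTrace y x c then h.choose else 0

theorem HasTrace.unique (hL : 0 < L) {y : L2 𝕜 L} {x : ℝ} (hx : x ∈ Icc 0 L) {c d : 𝕜}
    (hc : HasTrace y x c) (hd : HasTrace y x d) : c = d := by
  obtain ⟨f, hf, hyf, rfl⟩ := hc
  obtain ⟨g, hg, hyg, rfl⟩ := hd
  have hfg : f =ᵐ[volume.restrict (Ioo 0 L)] g := hyf.symm.trans hyg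
  have h1 : EqOn f g (Ioo 0 L) :=
    Measure.eqOn_open_of_ae_eq hfg isOpen_Ioo (hf.mono Ioo_subset_Icc_self)
      (hg.mono Ioo_subset_Icc_self)
  have h2 : EqOn f g (Icc 0 L) :=
    h1.of_subset_closure hf hg Ioo_subset_Icc_self (by rw [closure_Ioo hL.ne])
  exact h2 hx

theorem HasTrace.trace_eq (hL : 0 < L) {y : L2 𝕜 L} {x : ℝ} (hx : x ∈ Icc 0 L) {c : 𝕜}
    (hc : HasTrace y x c) : trace y x = c := by
  have h : ∃ c, HasTrace y x c := ⟨c, hc⟩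
  rw [trace, dif_pos h]
  exact h.choose_spec.unique hL hx hc

theorem HasTrace.zero (x : ℝ) : HasTrace (0 : L2 𝕜 L) x 0 :=
  ⟨fun _ => 0, continuousOn_const, Lp.coeFn_zero _ _ _, rfl⟩

theorem HasTrace.add {y z : L2 𝕜 L} {x : ℝ} {c d : 𝕜} (hy : HasTrace y x c)
    (hz : HasTrace z x d) : HasTrace (y + z) x (c + d) := by
  obtain ⟨f, hf, hyf, rfl⟩ := hy
  obtain ⟨g, hg, hzg, rfl⟩ := hz
  exact ⟨f + g, hf.add hg, (Lp.coeFn_add y z).trans (hyf.add hzg), rfl⟩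

theorem HasTrace.smul (a : 𝕜) {y : L2 𝕜 L} {x : ℝ} {c : 𝕜} (hy : HasTrace y x c) :
    HasTrace (a • y) x (a * c) := by
  obtain ⟨f, hf, hyf, rfl⟩ := hy
  exact ⟨a • f, hf.const_smul a, (Lp.coeFn_smul a y).trans (hyf.const_smul a), rfl⟩

theorem integrable_coe (y : L2 𝕜 L) : Integrable y (μI L) :=
  (Lp.memLp y).integrable (by norm_num)

theorem integrable_smul_coe (y : L2 𝕜 L) {φ : ℝ → ℝ} (h : Continuous φ)
    (hc : HasCompactSupport φ) : Integrable (fun x => φ x • y x) (μI L) := by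
  obtain ⟨C, hC⟩ := hc.exists_bound_of_continuous h
  exact (integrable_coe y).bdd_smul C h.aestronglyMeasurable (.of_forall hC)

theorem HasWeakDeriv.unique {y g₁ g₂ : L2 𝕜 L} (h₁ : HasWeakDeriv y g₁)
    (h₂ : HasWeakDeriv y g₂) : g₁ = g₂ := by
  rw [← sub_eq_zero]
  have key := isOpen_Ioo.ae_eq_zero_of_integral_contDiff_smul_eq_zero (U := Ioo 0 L)
    (μ := μI L) (f := (g₁ - g₂ : L2 𝕜 L))
    ((integrable_coe (g₁ - g₂)).locallyIntegrable.locallyIntegrableOn _) (by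
      intro φ hφ hc hs
      have e : ∫ x, φ x • (g₁ - g₂ : L2 𝕜 L) x ∂μI L = ∫ x, (φ x • g₁ x - φ x • g₂ x) ∂μI L := by
        refine integral_congr_ae ?_
        filter_upwards [Lp.coeFn_sub g₁ g₂] with x hx
        rw [hx, Pi.sub_apply, smul_sub]
      rw [e, integral_sub (integrable_smul_coe g₁ hφ.continuous hc)
        (integrable_smul_coe g₂ hφ.continuous hc), sub_eq_zero]
      exact neg_injective ((h₁ φ hφ hc hs).symm.trans (h₂ φ hφ hc hs)))
  rw [Lp.eq_zero_iff_ae_eq_zero]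
  filter_upwards [key, ae_restrict_mem measurableSet_Ioo] with x hx hm using hx hm

theorem HasWeakDeriv.zero : HasWeakDeriv (0 : L2 𝕜 L) 0 := by
  intro φ _ _ _
  have h0 : ((0 : L2 𝕜 L) : ℝ → 𝕜) =ᵐ[μI L] 0 := Lp.coeFn_zero _ _ _
  have h (ψ : ℝ → ℝ) : ∫ x, ψ x • (0 : L2 𝕜 L) x ∂μI L = 0 := by
    refine integral_eq_zero_of_ae ?_
    filter_upwards [h0] with x hx
    rw [hx, Pi.zero_apply, smul_zero]
  rw [h, h, neg_zero]

theorem HasWeakDeriv.add {y₁ y₂ g₁ g₂ : L2 𝕜 L} (h₁ : HasWeakDeriv y₁ g₁)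
    (h₂ : HasWeakDeriv y₂ g₂) : HasWeakDeriv (y₁ + y₂) (g₁ + g₂) := by
  intro φ hφ hc hs
  have h (ψ : ℝ → ℝ) (hψ : Continuous ψ) (hψc : HasCompactSupport ψ) (a b : L2 𝕜 L) :
      ∫ x, ψ x • (a + b : L2 𝕜 L) x ∂μI L
        = (∫ x, ψ x • a x ∂μI L) + ∫ x, ψ x • b x ∂μI L := by
    rw [← integral_add (integrable_smul_coe a hψ hψc) (integrable_smul_coe b hψ hψc)]
    refine integral_congr_ae ?_
    filter_upwards [Lp.coeFn_add a b] with x hx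
    rw [hx, Pi.add_apply, smul_add]
  rw [h _ (hφ.continuous_deriv (by simp)) hc.deriv, h _ hφ.continuous hc, h₁ φ hφ hc hs,
    h₂ φ hφ hc hs, neg_add]

theorem HasWeakDeriv.smul (a : 𝕜) {y g : L2 𝕜 L} (h : HasWeakDeriv y g) :
    HasWeakDeriv (a • y) (a • g) := by
  intro φ hφ hc hs
  have h' (ψ : ℝ → ℝ) (b : L2 𝕜 L) :
      ∫ x, ψ x • (a • b : L2 𝕜 L) x ∂μI L = a • ∫ x, ψ x • b x ∂μI L := by
    rw [← integral_smul]
    refine integral_congr_ae ?_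
    filter_upwards [Lp.coeFn_smul a b] with x hx
    rw [hx, Pi.smul_apply, smul_comm]
  rw [h', h', h φ hφ hc hs, smul_neg]

variable (𝕜 L) in
/-- The domain `{y ∈ H¹(0, L) | y(L) = 0}`. -/
def generatorDomain : Submodule 𝕜 (L2 𝕜 L) where
  carrier := {y | (∃ g, HasWeakDeriv y g) ∧ HasTrace y L 0}
  zero_mem' := ⟨⟨0, HasWeakDeriv.zero⟩, HasTrace.zero L⟩
  add_mem' := by
    rintro y z ⟨⟨g, hg⟩, hy⟩ ⟨⟨h, hh⟩, hz⟩
    exact ⟨⟨g + h, hg.add hh⟩, by simpa using hy.add hz⟩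
  smul_mem' := by
    rintro a y ⟨⟨g, hg⟩, hy⟩
    exact ⟨⟨a • g, hg.smul a⟩, by simpa using hy.smul a⟩

variable (𝕜 L) in
/-- `y ↦ y_x`, with domain `{y ∈ H¹(0, L) | y(L) = 0}`. -/
def weakDeriv : generatorDomain 𝕜 L →ₗ[𝕜] L2 𝕜 L where
  toFun y := y.2.1.choose
  map_add' y z := (y + z).2.1.choose_spec.unique (y.2.1.choose_spec.add z.2.1.choose_spec)
  map_smul' a y := (a • y).2.1.choose_spec.unique (y.2.1.choose_spec.smul a)

theorem weakDeriv_spec (y : generatorDomain 𝕜 L) : HasWeakDeriv (y : L2 𝕜 L) (weakDeriv 𝕜 L y) :=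
  y.2.1.choose_spec

section Kernel

variable {k : ℝ × ℝ → ℝ}

theorem kernel_section_memLp (hk : MemLp k 2 ((μI L).prod (μI L))) :
    ∀ᵐ x ∂μI L, MemLp (fun ξ => k (x, ξ)) 2 (μI L) := by
  have h2 := hk.integrable_sq
  filter_upwards [h2.prod_right_ae, hk.aestronglyMeasurable.prodMk_left] with x hx hm
  exact (memLp_two_iff_integrable_sq hm).2 hx

theorem kernel_integrable (hk : MemLp k 2 ((μI L).prod (μI L))) (y : L2 𝕜 L) :
    ∀ᵐ x ∂μI L, Integrable (fun ξ => k (x, ξ) • y ξ) (μI L) := by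
  filter_upwards [kernel_section_memLp hk] with x hx
  exact memLp_one_iff_integrable.1 ((Lp.memLp y).smul (p := 2) (q := 2) (r := 1) hx)

theorem kernel_aestronglyMeasurable (hk : MemLp k 2 ((μI L).prod (μI L))) (y : L2 𝕜 L) :
    AEStronglyMeasurable (fun x => ∫ ξ in Ioo 0 L, k (x, ξ) • y ξ) (μI L) :=
  (hk.aestronglyMeasurable.smul (Lp.aestronglyMeasurable y).comp_snd).integral_prod_right'

theorem eLpNorm_two_sq {α E : Type*} [MeasurableSpace α] [NormedAddCommGroup E] (μ : Measure α)
    (f : α → E) : eLpNorm f 2 μ ^ 2 = ∫⁻ x, ‖f x‖ₑ ^ 2 ∂μ := by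
  have := eLpNorm_nnreal_pow_eq_lintegral (f := f) (μ := μ) (p := 2) (by norm_num)
  simpa using this

theorem kernel_eLpNorm_le (hk : MemLp k 2 ((μI L).prod (μI L))) (y : L2 𝕜 L) :
    eLpNorm (fun x => ∫ ξ in Ioo 0 L, k (x, ξ) • y ξ) 2 (μI L)
      ≤ eLpNorm k 2 ((μI L).prod (μI L)) * eLpNorm y 2 (μI L) := by
  have hpow : (eLpNorm (fun x => ∫ ξ in Ioo 0 L, k (x, ξ) • y ξ) 2 (μI L)) ^ 2
      ≤ (eLpNorm k 2 ((μI L).prod (μI L)) * eLpNorm y 2 (μI L)) ^ 2 := by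
    rw [mul_pow, eLpNorm_two_sq, eLpNorm_two_sq ((μI L).prod (μI L)),
      lintegral_prod _ (hk.aestronglyMeasurable.enorm.pow_const 2),
      ← lintegral_mul_const' _ _ (ENNReal.pow_ne_top (Lp.memLp y).eLpNorm_ne_top)]
    refine lintegral_mono_ae ?_
    filter_upwards [kernel_section_memLp hk] with x hx
    rw [← eLpNorm_two_sq (μI L) (fun ξ => k (x, ξ)), ← mul_pow]
    refine pow_le_pow_left' ?_ 2
    refine (enorm_integral_le_lintegral_enorm _).trans ?_
    rw [← eLpNorm_one_eq_lintegral_enorm]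
    have h := eLpNorm_smul_le_mul_eLpNorm (p := 2) (q := 2) (r := 1) (μ := μI L)
      (Lp.aestronglyMeasurable y) hx.aestronglyMeasurable
    exact h
  exact (ENNReal.pow_le_pow_left_iff (by norm_num)).1 hpow

theorem kernel_memLp (hk : MemLp k 2 ((μI L).prod (μI L))) (y : L2 𝕜 L) :
    MemLp (fun x => ∫ ξ in Ioo 0 L, k (x, ξ) • y ξ) 2 (μI L) :=
  ⟨kernel_aestronglyMeasurable hk y, (kernel_eLpNorm_le hk y).trans_lt
    (ENNReal.mul_lt_top hk.eLpNorm_lt_top (Lp.memLp y).eLpNorm_lt_top)⟩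

variable (𝕜) in
/-- The integral operator `(K y)(x) = ∫₀^L k(x, ξ) y(ξ) dξ` on `L²(0, L; 𝕜)`, for a real kernel `k`
(over `𝕜 = ℂ`, it is the complexification of the operator over `ℝ`). -/
def integralOperator (k : ℝ × ℝ → ℝ) (hk : MemLp k 2 ((μI L).prod (μI L))) :
    L2 𝕜 L →L[𝕜] L2 𝕜 L :=
  LinearMap.mkContinuous
    { toFun := fun y => (kernel_memLp hk y).toLp _
      map_add' := fun y z => by
        rw [← MemLp.toLp_add, MemLp.toLp_eq_toLp_iff]
        filter_upwards [kernel_integrable hk y, kernel_integrable hk z] with x hy hz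
        rw [Pi.add_apply, ← integral_add hy hz]
        refine integral_congr_ae ?_
        filter_upwards [Lp.coeFn_add y z] with ξ h
        rw [h, Pi.add_apply, smul_add]
      map_smul' := fun a y => by
        rw [RingHom.id_apply, ← MemLp.toLp_const_smul, MemLp.toLp_eq_toLp_iff]
        refine .of_forall fun x => ?_
        rw [Pi.smul_apply, ← integral_smul]
        refine integral_congr_ae ?_
        filter_upwards [Lp.coeFn_smul a y] with ξ h
        rw [h, Pi.smul_apply, smul_comm] }
    (eLpNorm k 2 ((μI L).prod (μI L))).toReal (fun y => by
      change ‖(kernel_memLp hk y).toLp _‖ ≤ _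
      rw [Lp.norm_toLp, Lp.norm_def, ← ENNReal.toReal_mul]
      exact ENNReal.toReal_mono
        (ENNReal.mul_ne_top hk.eLpNorm_ne_top (Lp.memLp y).eLpNorm_ne_top)
        (kernel_eLpNorm_le hk y))

variable (𝕜) in
/-- The operator `A_K y = y_x + ∫₀^L k(·, ξ) y(ξ) dξ` on `L²(0, L; 𝕜)`, with domain
`{y ∈ H¹(0, L) | y(L) = 0}`. -/
def generator (k : ℝ × ℝ → ℝ) (hk : MemLp k 2 ((μI L).prod (μI L))) :
    L2 𝕜 L →ₗ.[𝕜] L2 𝕜 L where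
  domain := generatorDomain 𝕜 L
  toFun := weakDeriv 𝕜 L + (integralOperator 𝕜 k hk).toLinearMap ∘ₗ (generatorDomain 𝕜 L).subtype

variable (𝕜) in
/-- The adjoint `B* z = z(L)`, `z ∈ D(A_K*) ⊆ H¹(0, L)`, of the control operator
`⟨B u, z⟩ = u z(L)`. -/
def controlAdjoint (k : ℝ × ℝ → ℝ) (hk : MemLp k 2 ((μI L).prod (μI L)))
    (z : (generator 𝕜 k hk)†.domain) : 𝕜 :=
  trace (z : L2 𝕜 L) L

end Kernel

end

end IntegralTransport

/-!
Extend the equation to all real `x`, cutting the integral term off to `(0, L)`: the state of the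
control system is then the restriction to `(0, L)` of the flow of `w_t = w_x + Kw`, and the control
is the part of `w(0, ·)` to the right of `L`. By Duhamel's formula the flow is the left translation
plus a compact operator. At a time `T ≥ L` the translation alone carries data beyond
`L` onto all of `L²(0, L)`, so the reachable space contains the range of `1 + C` with `C` compact.
It is therefore closed and of finite codimension, hence it is dense only if it is everything.

For `T > L` the orthogonal complements `R(t)ᗮ`, `t ∈ [L, T]`, of the reachable spaces are finite
dimensional and decrease with `t`, so that two of them coincide; such a complement is invariant
under the adjoint semigroup. If it is not zero, it contains an eigenvector `z` of `A*`, and testing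
with an exponential control gives `z(L) = 0`, against the Fattorini criterion. Conversely, an
eigenvector with `z(L) = 0` is orthogonal to every state reachable from `0`. Real kernels make
reachability over `ℝ` and over `ℂ` equivalent, by real and imaginary parts.
-/

open Filter Topology
open scoped ENNReal InnerProductSpace

section FiniteCodimension

variable {𝕜 H : Type*} [RCLike 𝕜] [NormedAddCommGroup H] [InnerProductSpace 𝕜 H]

variable (𝕜) in
theorem exists_finiteDimensional_norm_sub_starProjection_le {Ω : Set H} (hΩ : TotallyBounded Ω)
    {δ : ℝ} (hδ : 0 < δ) :
    ∃ V : Submodule 𝕜 H, ∃ _ : FiniteDimensional 𝕜 V, ∀ v ∈ Ω, ‖v - V.starProjection v‖ ≤ δ := by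
  obtain ⟨t, ht, hcov⟩ := Metric.totallyBounded_iff.1 hΩ δ hδ
  have hfin := FiniteDimensional.span_of_finite 𝕜 ht
  refine ⟨Submodule.span 𝕜 t, hfin, fun v hv => ?_⟩
  obtain ⟨c, hc, hcv⟩ := mem_iUnion₂.1 (hcov hv)
  rw [Submodule.starProjection_minimal]
  refine (ciInf_le ⟨0, by rintro _ ⟨y, rfl⟩; positivity⟩
    (⟨c, Submodule.subset_span hc⟩ : Submodule.span 𝕜 t)).trans ?_
  exact (dist_eq_norm v c).symm.trans_le (Metric.mem_ball.1 hcv).le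

open scoped LinearMap.FiniteRangeSetoid in
theorem isFredholm_one_add_of_isCompactOperator [CompleteSpace H] {C : H →L[𝕜] H}
    (hC : IsCompactOperator C) : (1 + C).IsFredholm := by
  obtain ⟨V, _, hV⟩ := exists_finiteDimensional_norm_sub_starProjection_le 𝕜
    (hC.isCompact_closure_image_closedBall (f := (C : H →ₗ[𝕜] H)) 1).totallyBounded one_half_pos
  set P : H →L[𝕜] H := V.starProjection
  have hsmall : ‖-(C - P ∘L C)‖ < 1 := by
    rw [norm_neg]
    refine (ContinuousLinearMap.opNorm_le_of_unit_norm one_half_pos.le fun x hx => ?_).trans_lt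
      one_half_lt_one
    exact hV _ (subset_closure ⟨x, by simp [hx], rfl⟩)
  let X : H ≃L[𝕜] H := ContinuousLinearEquiv.unitsEquiv 𝕜 H (Units.oneSub _ hsmall)
  have hX : (X : H →L[𝕜] H) = 1 + C - P ∘L C :=
    (sub_neg_eq_add 1 (C - P ∘L C)).trans (add_sub_assoc 1 C (P ∘L C)).symm
  have hfin : ((1 + C : H →L[𝕜] H) : H →ₗ[𝕜] H) ≈ X.toLinearEquiv := by
    rw [LinearMap.FiniteRangeSetoid.equiv_iff_hasFiniteRange]
    have hsub : ((1 + C : H →L[𝕜] H) : H →ₗ[𝕜] H) - X.toLinearEquiv = (P ∘L C : H →L[𝕜] H) := by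
      change ((1 + C : H →L[𝕜] H) : H →ₗ[𝕜] H) - ((X : H →L[𝕜] H) : H →ₗ[𝕜] H) = _
      rw [hX, ← ContinuousLinearMap.toLinearMap_sub, sub_sub_cancel]
    rw [hsub, LinearMap.hasFiniteRange_iff_range]
    refine (Module.Finite.iff_fg.1 ‹FiniteDimensional 𝕜 V›).of_le ?_
    rintro _ ⟨x, rfl⟩
    exact Submodule.starProjection_apply_mem V (C x)
  exact ContinuousLinearMap.IsFredholm.of_isQuasiInverse (v := (X.symm : H →L[𝕜] H))
    (X.toLinearEquiv.isQuasiInverse.congr (Setoid.refl _) hfin)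

theorem isClosed_and_finiteDimensional_orthogonal_of_range_le {T : H →L[𝕜] H}
    (hT : T.IsFredholm) {E : Submodule 𝕜 H} (h : T.range ≤ E) :
    IsClosed (E : Set H) ∧ FiniteDimensional 𝕜 Eᗮ := by
  have hfin : FiniteDimensional 𝕜 (H ⧸ T.range) := hT.finite_coker
  refine ⟨Submodule.isClosed_mono_of_finiteDimensional_quotient hT.isClosed_range h, ?_⟩
  have hinj : Function.Injective (T.range.mkQ ∘ₗ Eᗮ.subtype) := by
    rw [injective_iff_map_eq_zero]
    rintro ⟨x, hx⟩ h0
    have hxE : x ∈ E := h ((Submodule.Quotient.mk_eq_zero _).1 h0)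
    exact Subtype.ext (inner_self_eq_zero.1 (hx x hxE))
  exact FiniteDimensional.of_injective _ hinj

end FiniteCodimension

/-- A strongly continuous semigroup of bounded operators. Only the times `t ≥ 0` are meaningful;
the orbits are continuous on all of `ℝ` so that they can be integrated without restricting them. -/
structure C0Semigroup (𝕜 E : Type*) [RCLike 𝕜] [NormedAddCommGroup E] [NormedSpace 𝕜 E] where
  toFun : ℝ → E →L[𝕜] E
  map_zero' : ∀ x, toFun 0 x = x
  map_add' : ∀ s t, 0 ≤ s → 0 ≤ t → ∀ x, toFun (s + t) x = toFun s (toFun t x)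
  continuous_orbit' : ∀ x, Continuous fun t => toFun t x

/-- A strongly continuous semigroup of contractions. -/
structure ContractionSemigroup (𝕜 E : Type*) [RCLike 𝕜] [NormedAddCommGroup E] [NormedSpace 𝕜 E]
    extends C0Semigroup 𝕜 E where
  norm_apply_le' : ∀ t x, ‖toFun t x‖ ≤ ‖x‖

namespace C0Semigroup

variable {𝕜 E : Type*} [RCLike 𝕜] [NormedAddCommGroup E] [NormedSpace 𝕜 E]

instance : CoeFun (C0Semigroup 𝕜 E) fun _ => ℝ → E →L[𝕜] E := ⟨toFun⟩

variable (S : C0Semigroup 𝕜 E)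

theorem zero_apply (x : E) : S 0 x = x := S.map_zero' x

theorem add_apply {s t : ℝ} (hs : 0 ≤ s) (ht : 0 ≤ t) (x : E) : S (s + t) x = S s (S t x) :=
  S.map_add' s t hs ht x

theorem continuous_orbit (x : E) : Continuous fun t => S t x := S.continuous_orbit' x

theorem exists_norm_le [CompleteSpace E] (a b : ℝ) : ∃ M, ∀ t ∈ Icc a b, ‖S t‖ ≤ M := by
  obtain ⟨M, hM⟩ := banach_steinhaus (g := fun t : Icc a b => S t) fun x => by
    obtain ⟨C, hC⟩ := isCompact_Icc.exists_bound_of_continuousOn (s := Icc a b)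
      (S.continuous_orbit x).continuousOn
    exact ⟨C, fun t => hC t t.2⟩
  exact ⟨M, fun t ht => hM ⟨t, ht⟩⟩

variable [NormedSpace ℝ E]

/-- `x` belongs to the domain of the infinitesimal generator of `S`, which maps it to `g`. -/
def HasGeneratorAt (x g : E) : Prop := HasDerivWithinAt (fun t => S t x) g (Ici 0) 0

variable {S} {x g : E} [IsScalarTower ℝ 𝕜 E]

theorem HasGeneratorAt.hasDerivWithinAt (hx : S.HasGeneratorAt x g) {t : ℝ} (ht : 0 ≤ t) :
    HasDerivWithinAt (fun s => S s x) (S t g) (Ici t) t := by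
  have hshift : HasDerivWithinAt (fun s => S (s - t) x) g (Ici t) t := by
    have hx' : HasDerivWithinAt (fun t => S t x) g (Ici 0) (t - t) := by rwa [sub_self]
    simpa [Function.comp_def] using
      hx'.scomp t (h := fun s => s - t) ((hasDerivWithinAt_id t (Ici t)).sub_const t)
        fun s hs => sub_nonneg.2 (mem_Ici.1 hs)
  refine (((S t).restrictScalars ℝ).hasFDerivAt.comp_hasDerivWithinAt t hshift).congr
    (fun s hs => ?_) ?_
  · simpa using S.add_apply ht (sub_nonneg.2 hs) x
  · simp [S.zero_apply]

theorem HasGeneratorAt.apply (hx : S.HasGeneratorAt x g) {t : ℝ} (ht : 0 ≤ t) :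
    S.HasGeneratorAt (S t x) (S t g) :=
  (((S t).restrictScalars ℝ).hasFDerivAt.comp_hasDerivWithinAt 0 hx).congr
    (fun s hs => by
      simp only [Function.comp_apply, ContinuousLinearMap.coe_restrictScalars',
        ← S.add_apply ht (mem_Ici.1 hs), ← S.add_apply (mem_Ici.1 hs) ht, add_comm])
    (by simp only [Function.comp_apply, ContinuousLinearMap.coe_restrictScalars', S.zero_apply])

theorem HasGeneratorAt.integral_eq_sub [CompleteSpace E] (hx : S.HasGeneratorAt x g) {a b : ℝ}
    (ha : 0 ≤ a) (hab : a ≤ b) : ∫ s in a..b, S s g = S b x - S a x :=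
  intervalIntegral.integral_eq_sub_of_hasDeriv_right_of_le hab (S.continuous_orbit x).continuousOn
    (fun _ ht => (hx.hasDerivWithinAt (ha.trans ht.1.le)).mono Ioi_subset_Ici_self)
    ((S.continuous_orbit g).intervalIntegrable _ _)

end C0Semigroup

section RightDerivative

variable {E : Type*} [NormedAddCommGroup E] [NormedSpace ℝ E]

theorem hasDerivAt_integral_diagonal_zero [CompleteSpace E] {F : ℝ → ℝ → E}
    (hF : Continuous F.uncurry) :
    HasDerivAt (fun t => ∫ s in (0 : ℝ)..t, F t s) (F 0 0) 0 := by
  rw [hasDerivAt_iff_isLittleO_nhds_zero, Asymptotics.isLittleO_iff]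
  intro ε hε
  obtain ⟨δ, hδ, h⟩ := Metric.continuousAt_iff.1 (hF.continuousAt (x := (0, 0))) ε hε
  filter_upwards [Metric.ball_mem_nhds (0 : ℝ) hδ] with t ht
  have hint : ∀ s, Continuous (F s) := fun s => hF.comp (Continuous.prodMk_right s)
  have hdiff : (∫ s in (0 : ℝ)..t, F t s) - t • F 0 0 = ∫ s in (0 : ℝ)..t, (F t s - F 0 0) := by
    rw [intervalIntegral.integral_sub ((hint t).intervalIntegrable _ _)
      intervalIntegrable_const, intervalIntegral.integral_const, sub_zero]
  rw [zero_add, intervalIntegral.integral_same, sub_zero, hdiff]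
  refine (intervalIntegral.norm_integral_le_of_norm_le_const (C := ε) fun s hs => ?_).trans
    (by rw [sub_zero, Real.norm_eq_abs])
  have hst : |s| ≤ |t| := by
    rcases le_total 0 t with h0 | h0
    · rw [uIoc_of_le h0] at hs
      rw [abs_of_nonneg hs.1.le, abs_of_nonneg h0]
      exact hs.2
    · rw [uIoc_of_ge h0] at hs
      rw [abs_of_nonpos hs.2, abs_of_nonpos h0]
      linarith [hs.1]
  rw [← dist_eq_norm]
  refine (h (x := (t, s)) ?_).le
  rw [Prod.dist_eq, dist_zero_right, dist_zero_right]
  simpa using ⟨mem_ball_zero_iff.1 ht, hst.trans_lt (by simpa using ht)⟩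

end RightDerivative

namespace ContractionSemigroup

variable {𝕜 E : Type*} [RCLike 𝕜] [NormedAddCommGroup E] [NormedSpace 𝕜 E]

instance : CoeFun (ContractionSemigroup 𝕜 E) fun _ => ℝ → E →L[𝕜] E := ⟨fun S => S.toFun⟩

variable (S : ContractionSemigroup 𝕜 E)

theorem norm_apply_le (t : ℝ) (x : E) : ‖S t x‖ ≤ ‖x‖ := S.norm_apply_le' t x

theorem continuous_uncurry : Continuous fun p : ℝ × E => S p.1 p.2 :=
  continuous_prod_of_continuous_lipschitzWith' (K := 1) _
    (fun t => LipschitzWith.of_dist_le_mul fun x y => by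
      rw [dist_eq_norm, dist_eq_norm, ← map_sub, NNReal.coe_one, one_mul]
      exact S.norm_apply_le t _) S.continuous_orbit

end ContractionSemigroup

noncomputable section

open scoped BoundedContinuousFunction

namespace ContractionSemigroup

section Integrand

variable {𝕜 E : Type*} [RCLike 𝕜] [NormedAddCommGroup E] [NormedSpace 𝕜 E]
  (S : ContractionSemigroup 𝕜 E) (K : E →L[𝕜] E) {y : ℝ → E}

theorem continuous_uncurry_duhamel (hy : Continuous y) :
    Continuous fun p : ℝ × ℝ => S (p.1 - p.2) (K (y p.2)) :=
  S.continuous_uncurry.comp ((continuous_fst.sub continuous_snd).prodMk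
    (K.continuous.comp (hy.comp continuous_snd)))

theorem continuous_duhamel (hy : Continuous y) (t : ℝ) :
    Continuous fun s => S (t - s) (K (y s)) :=
  (S.continuous_uncurry_duhamel K hy).comp (Continuous.prodMk_right t)

/-- The rate of the exponential weight which makes the Volterra operator of Duhamel's formula a
contraction. -/
def rate (K : E →L[𝕜] E) : ℝ := 2 * ‖K‖ + 1

theorem rate_pos : 0 < rate K := by unfold rate; positivity

variable [NormedSpace ℝ E]

theorem continuous_weighted_duhamel (hy : Continuous y) :
    Continuous fun p : ℝ × ℝ =>
      Real.exp (-(rate K * (max p.1 0 - p.2))) • S (max p.1 0 - p.2) (K (y p.2)) :=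
  (by fun_prop : Continuous fun p : ℝ × ℝ => Real.exp (-(rate K * (max p.1 0 - p.2)))).smul
    ((S.continuous_uncurry_duhamel K hy).comp
      ((continuous_fst.max continuous_const).prodMk continuous_snd))

theorem continuous_weighted_duhamel_right (hy : Continuous y) (t : ℝ) :
    Continuous fun s => Real.exp (-(rate K * (max t 0 - s))) • S (max t 0 - s) (K (y s)) :=
  (S.continuous_weighted_duhamel K hy).comp (Continuous.prodMk_right t)

theorem eq_zero_of_eq_duhamel (hy : Continuous y) {t : ℝ}
    (h : ∀ r ∈ Icc 0 t, y r = ∫ s in (0 : ℝ)..r, S (r - s) (K (y s))) (ht : 0 ≤ t) :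
    y t = 0 := by
  have hint : ∀ s, IntervalIntegrable (fun r => ‖y r‖) volume 0 s := fun s =>
    hy.norm.intervalIntegrable _ _
  have hle : ∀ s ∈ Icc 0 t, ‖y s‖ ≤ ‖K‖ * ∫ r in (0 : ℝ)..s, ‖y r‖ := fun s hs => by
    conv_lhs => rw [h s hs]
    rw [← intervalIntegral.integral_const_mul]
    exact intervalIntegral.norm_integral_le_of_norm_le hs.1
      (.of_forall fun r _ => (S.norm_apply_le _ _).trans (K.le_opNorm _)) ((hint s).const_mul _)
  have hderiv : ∀ s, HasDerivAt (fun s => ∫ r in (0 : ℝ)..s, ‖y r‖) ‖y s‖ s := fun s =>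
    intervalIntegral.integral_hasDerivAt_right (hint s)
      (hy.norm.stronglyMeasurableAtFilter _ _) hy.norm.continuousAt
  have hgronwall := norm_le_gronwallBound_of_norm_deriv_right_le (δ := 0) (K := ‖K‖) (ε := 0)
    (fun s _ => (hderiv s).continuousAt.continuousWithinAt)
    (fun s _ => (hderiv s).hasDerivWithinAt) (by simp)
    (fun s hs => by
      rw [norm_norm, add_zero, Real.norm_of_nonneg
        (intervalIntegral.integral_nonneg hs.1 fun r _ => norm_nonneg _)]
      exact hle s (Ico_subset_Icc_self hs)) t ⟨ht, le_rfl⟩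
  rw [gronwallBound_ε0_δ0, norm_le_zero_iff] at hgronwall
  simpa [hgronwall] using hle t ⟨ht, le_rfl⟩

end Integrand

theorem integral_exp_neg_mul_sub_le {r : ℝ} (hr : 0 < r) (t : ℝ) :
    ∫ s in (0 : ℝ)..t, Real.exp (-(r * (t - s))) ≤ 1 / r := by
  have hderiv : ∀ s ∈ uIcc 0 t, HasDerivAt (fun s => Real.exp (-(r * (t - s))) / r)
      (Real.exp (-(r * (t - s)))) s := fun s _ => by
    have hexp : HasDerivAt (fun s => -(r * (t - s))) r s := by
      convert! (((hasDerivAt_id s).const_sub t).const_mul r).neg using 1; simp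
    have h := hexp.exp.div_const r
    rwa [mul_div_assoc, div_self hr.ne', mul_one] at h
  rw [intervalIntegral.integral_eq_sub_of_hasDerivAt hderiv
    (Continuous.intervalIntegrable (by fun_prop) _ _), sub_self, mul_zero, neg_zero, Real.exp_zero]
  exact sub_le_self _ (by positivity)

variable {𝕜 E : Type*} [RCLike 𝕜] [NormedAddCommGroup E] [NormedSpace 𝕜 E] [NormedSpace ℝ E]
  (S : ContractionSemigroup 𝕜 E) (K : E →L[𝕜] E)

theorem norm_integral_weighted_duhamel_le (y : ℝ →ᵇ E) (t : ℝ) :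
    ‖∫ s in (0 : ℝ)..max t 0, Real.exp (-(rate K * (max t 0 - s))) •
      S (max t 0 - s) (K (y s))‖ ≤ 1 / 2 * ‖y‖ := by
  have hbound : ∀ s, ‖Real.exp (-(rate K * (max t 0 - s))) • S (max t 0 - s) (K (y s))‖
      ≤ Real.exp (-(rate K * (max t 0 - s))) * (‖K‖ * ‖y‖) := fun s => by
    rw [norm_smul, Real.norm_of_nonneg (Real.exp_pos _).le]
    gcongr
    exact (S.norm_apply_le _ _).trans ((K.le_opNorm _).trans (by
      gcongr; exact y.norm_coe_le_norm s))
  have hrate : 1 / rate K * ‖K‖ ≤ 1 / 2 := by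
    rw [div_mul_eq_mul_div, one_mul, div_le_div_iff₀ (rate_pos K) two_pos, rate]
    linarith
  calc _ ≤ ∫ s in (0 : ℝ)..max t 0, Real.exp (-(rate K * (max t 0 - s))) * (‖K‖ * ‖y‖) :=
        intervalIntegral.norm_integral_le_of_norm_le (le_max_right _ _)
          (.of_forall fun s _ => hbound s) (Continuous.intervalIntegrable (by fun_prop) _ _)
    _ ≤ 1 / rate K * (‖K‖ * ‖y‖) := by
        rw [intervalIntegral.integral_mul_const]
        gcongr
        exact integral_exp_neg_mul_sub_le (rate_pos K) _
    _ = (1 / rate K * ‖K‖) * ‖y‖ := by ring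
    _ ≤ _ := by gcongr

theorem norm_exp_smul_apply_le (x : E) (t : ℝ) :
    ‖Real.exp (-(rate K * max t 0)) • S (max t 0) x‖ ≤ ‖x‖ := by
  rw [norm_smul, Real.norm_of_nonneg (Real.exp_pos _).le]
  have hexp : Real.exp (-(rate K * max t 0)) ≤ 1 := Real.exp_le_one_iff.2 (by
    have := mul_nonneg (rate_pos K).le (le_max_right t 0); linarith)
  exact (mul_le_mul hexp (S.norm_apply_le _ x) (norm_nonneg _) zero_le_one).trans (one_mul _).le

variable [IsScalarTower ℝ 𝕜 E]

/-- The Volterra operator `y ↦ ∫₀ᵗ S (t - s) K y(s) ds` of Duhamel's formula, conjugated with the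
weight `e^{-rate K · t}` and extended by its value at `0` to negative times, so that it acts on
bounded continuous functions. -/
def volterra : (ℝ →ᵇ E) →L[𝕜] (ℝ →ᵇ E) :=
  LinearMap.mkContinuous
    { toFun := fun y => BoundedContinuousFunction.ofNormedAddCommGroup
        (fun t => ∫ s in (0 : ℝ)..max t 0, Real.exp (-(rate K * (max t 0 - s))) •
          S (max t 0 - s) (K (y s)))
        (intervalIntegral.continuous_parametric_intervalIntegral_of_continuous
          (S.continuous_weighted_duhamel K y.continuous) (continuous_id.max continuous_const))
        _ (S.norm_integral_weighted_duhamel_le K y)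
      map_add' := fun x y => by
        ext1 t
        have hint (y : ℝ →ᵇ E) := (S.continuous_weighted_duhamel_right K y.continuous
          t).intervalIntegrable (μ := volume) 0 (max t 0)
        simp only [BoundedContinuousFunction.coe_ofNormedAddCommGroup,
          BoundedContinuousFunction.add_apply, map_add, smul_add]
        exact intervalIntegral.integral_add (hint x) (hint y)
      map_smul' := fun a y => by
        ext1 t
        simp only [BoundedContinuousFunction.coe_ofNormedAddCommGroup,
          BoundedContinuousFunction.smul_apply, map_smul, RingHom.id_apply]
        rw [← intervalIntegral.integral_smul]
        simp only [smul_comm a] } (1 / 2) fun y =>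
      BoundedContinuousFunction.norm_ofNormedAddCommGroup_le _ (by positivity)
        (S.norm_integral_weighted_duhamel_le K y)

theorem volterra_apply (y : ℝ →ᵇ E) (t : ℝ) :
    S.volterra K y t = ∫ s in (0 : ℝ)..max t 0, Real.exp (-(rate K * (max t 0 - s))) •
      S (max t 0 - s) (K (y s)) := rfl

theorem norm_volterra_lt_one : ‖S.volterra K‖ < 1 :=
  (LinearMap.mkContinuous_norm_le _ (by norm_num) _).trans_lt (by norm_num)

/-- The orbit map of the unperturbed semigroup, with the same weight and the same extension to
negative times as `volterra`. -/
def weightedOrbit : E →L[𝕜] (ℝ →ᵇ E) :=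
  LinearMap.mkContinuous
    { toFun := fun x => BoundedContinuousFunction.ofNormedAddCommGroup
        (fun t => Real.exp (-(rate K * max t 0)) • S (max t 0) x)
        (Continuous.smul (by fun_prop) ((S.continuous_orbit x).comp
          (continuous_id.max continuous_const))) ‖x‖ (S.norm_exp_smul_apply_le K x)
      map_add' := fun x y => by
        ext1 t
        simp only [BoundedContinuousFunction.coe_ofNormedAddCommGroup,
          BoundedContinuousFunction.add_apply, map_add, smul_add]
      map_smul' := fun a x => by
        ext1 t
        simp only [BoundedContinuousFunction.coe_ofNormedAddCommGroup,
          BoundedContinuousFunction.smul_apply, map_smul, RingHom.id_apply, smul_comm a] }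
    1 fun x => by
      rw [one_mul]
      exact BoundedContinuousFunction.norm_ofNormedAddCommGroup_le _ (norm_nonneg _)
        (S.norm_exp_smul_apply_le K x)

theorem weightedOrbit_apply (x : E) (t : ℝ) :
    S.weightedOrbit K x t = Real.exp (-(rate K * max t 0)) • S (max t 0) x := rfl

variable [CompleteSpace E]

/-- The weighted orbit map of the perturbed semigroup, as the Neumann series of the Volterra
operator. -/
def perturbedWeightedOrbit : E →L[𝕜] (ℝ →ᵇ E) :=
  ((Units.oneSub (S.volterra K) (S.norm_volterra_lt_one K))⁻¹ :
    ((ℝ →ᵇ E) →L[𝕜] (ℝ →ᵇ E))ˣ).val ∘L S.weightedOrbit K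

theorem perturbedWeightedOrbit_eq (x : E) : S.perturbedWeightedOrbit K x
    = S.weightedOrbit K x + S.volterra K (S.perturbedWeightedOrbit K x) := by
  have h : S.perturbedWeightedOrbit K x - S.volterra K (S.perturbedWeightedOrbit K x)
      = S.weightedOrbit K x :=
    congrArg (fun f : (ℝ →ᵇ E) →L[𝕜] (ℝ →ᵇ E) => f (S.weightedOrbit K x))
      (Units.mul_inv (Units.oneSub (S.volterra K) (S.norm_volterra_lt_one K)))
  rw [← h, sub_add_cancel]

/-- The operators of the perturbed semigroup, with the weight of `perturbedWeightedOrbit`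
removed. -/
def perturbFun (t : ℝ) : E →L[𝕜] E :=
  (Real.exp (rate K * max t 0) : 𝕜) •
    (BoundedContinuousFunction.evalCLM 𝕜 t ∘L S.perturbedWeightedOrbit K)

theorem perturbFun_apply (t : ℝ) (x : E) : S.perturbFun K t x
    = Real.exp (rate K * max t 0) • S.perturbedWeightedOrbit K x t :=
  RCLike.real_smul_eq_coe_smul (K := 𝕜) _ _ |>.symm

theorem continuous_perturbFun (x : E) : Continuous fun t => S.perturbFun K t x := by
  simp only [perturbFun_apply]
  exact Continuous.smul (by fun_prop) (S.perturbedWeightedOrbit K x).continuous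

theorem perturbFun_eq {t : ℝ} (ht : 0 ≤ t) (x : E) : S.perturbFun K t x
    = S t x + ∫ s in (0 : ℝ)..t, S (t - s) (K (S.perturbFun K s x)) := by
  have hcancel : ∀ s, 0 ≤ s → Real.exp (rate K * t) • Real.exp (-(rate K * (t - s))) •
      S (t - s) (K (S.perturbedWeightedOrbit K x s)) = S (t - s) (K (S.perturbFun K s x)) :=
    fun s hs => by
      rw [perturbFun_apply, ContinuousLinearMap.map_smul_of_tower,
        ContinuousLinearMap.map_smul_of_tower, smul_smul, ← Real.exp_add,
        max_eq_left hs]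
      congr 2
      ring
  rw [perturbFun_apply, perturbedWeightedOrbit_eq, BoundedContinuousFunction.add_apply, smul_add,
    weightedOrbit_apply, volterra_apply, max_eq_left ht, smul_smul, ← Real.exp_add,
    add_neg_cancel, Real.exp_zero, one_smul, ← intervalIntegral.integral_smul]
  congr 1
  refine intervalIntegral.integral_congr fun s hs => hcancel s ?_
  rw [uIcc_of_le ht] at hs
  exact hs.1

theorem eq_perturbFun {y : ℝ → E} (hy : Continuous y) {x : E} {t : ℝ}
    (h : ∀ r ∈ Icc 0 t, y r = S r x + ∫ s in (0 : ℝ)..r, S (r - s) (K (y s)))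
    (ht : 0 ≤ t) : y t = S.perturbFun K t x := by
  have hcont := S.continuous_perturbFun K x
  refine sub_eq_zero.1 (S.eq_zero_of_eq_duhamel K (y := fun t => y t - S.perturbFun K t x)
    (hy.sub hcont) (fun r hr => ?_) ht)
  rw [h r hr, S.perturbFun_eq K hr.1, add_sub_add_left_eq_sub, ← intervalIntegral.integral_sub
    ((S.continuous_duhamel K hy r).intervalIntegrable _ _)
    ((S.continuous_duhamel K hcont r).intervalIntegrable _ _)]
  simp only [map_sub]

theorem perturbFun_zero (x : E) : S.perturbFun K 0 x = x := by
  rw [S.perturbFun_eq K le_rfl, intervalIntegral.integral_same, add_zero, S.zero_apply]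

theorem perturbFun_add {s t : ℝ} (hs : 0 ≤ s) (ht : 0 ≤ t) (x : E) :
    S.perturbFun K (s + t) x = S.perturbFun K s (S.perturbFun K t x) := by
  have hcont := S.continuous_perturbFun K x
  refine S.eq_perturbFun K (y := fun s => S.perturbFun K (s + t) x)
    (hcont.comp (continuous_add_const t)) (fun s ⟨hs, _⟩ => ?_) hs
  have hint (r a b) := (S.continuous_duhamel K hcont r).intervalIntegrable (μ := volume) a b
  have hleft : S (s + t) x + ∫ r in (0 : ℝ)..t, S (s + t - r) (K (S.perturbFun K r x))
      = S s (S.perturbFun K t x) := by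
    rw [S.perturbFun_eq K ht, map_add, ← S.add_apply hs ht,
      ← ContinuousLinearMap.intervalIntegral_comp_comm _ (hint t 0 t)]
    congr 1
    refine intervalIntegral.integral_congr fun r hr => ?_
    rw [uIcc_of_le ht] at hr
    simp only [← S.add_apply hs (sub_nonneg.2 hr.2), add_sub_assoc]
  have hright : ∫ r in t..s + t, S (s + t - r) (K (S.perturbFun K r x))
      = ∫ r in (0 : ℝ)..s, S (s - r) (K (S.perturbFun K (r + t) x)) := by
    have h := intervalIntegral.integral_comp_add_right (a := 0) (b := s)
      (fun r => S (s + t - r) (K (S.perturbFun K r x))) t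
    simpa only [add_sub_add_right_eq_sub, zero_add] using h.symm
  rw [S.perturbFun_eq K (add_nonneg hs ht),
    ← intervalIntegral.integral_add_adjacent_intervals (hint _ 0 t) (hint _ t (s + t)),
    ← add_assoc, hleft, hright]

/-- The semigroup generated by the generator of `S` perturbed by the bounded operator `K`. -/
def perturb : C0Semigroup 𝕜 E where
  toFun := S.perturbFun K
  map_zero' := S.perturbFun_zero K
  map_add' _ _ hs ht := S.perturbFun_add K hs ht
  continuous_orbit' := S.continuous_perturbFun K

theorem perturb_eq {t : ℝ} (ht : 0 ≤ t) (x : E) : S.perturb K t x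
    = S t x + ∫ s in (0 : ℝ)..t, S (t - s) (K (S.perturb K s x)) :=
  S.perturbFun_eq K ht x

theorem eq_perturb {y : ℝ → E} (hy : Continuous y) {x : E} {t : ℝ}
    (h : ∀ r ∈ Icc 0 t, y r = S r x + ∫ s in (0 : ℝ)..r, S (r - s) (K (y s))) (ht : 0 ≤ t) :
    y t = S.perturb K t x :=
  S.eq_perturbFun K hy h ht

end ContractionSemigroup

end

open scoped Pointwise in
theorem intervalIntegral_mem_smul_of_convex {E : Type*} [NormedAddCommGroup E] [NormedSpace ℝ E]
    [CompleteSpace E] {C : Set E} (hC : Convex ℝ C) (hCc : IsClosed C) {f : ℝ → E} {a b : ℝ}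
    (hab : a < b) (hf : IntervalIntegrable f volume a b) (hfC : ∀ s ∈ Ioc a b, f s ∈ C) :
    ∫ s in a..b, f s ∈ (b - a) • C := by
  rw [intervalIntegral.integral_of_le hab.le, ← measure_smul_setAverage f measure_Ioc_lt_top.ne,
    measureReal_def, Real.volume_Ioc, ENNReal.toReal_ofReal (sub_nonneg.2 hab.le)]
  refine smul_mem_smul_set (hC.set_average_mem hCc ?_ measure_Ioc_lt_top.ne
    ((ae_restrict_iff' measurableSet_Ioc).2 (.of_forall hfC)) hf.1)
  rw [Real.volume_Ioc, Ne, ENNReal.ofReal_eq_zero, not_le]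
  exact sub_pos.2 hab

namespace ContractionSemigroup

section Intertwining

variable {𝕜 𝕜' E F : Type*} [RCLike 𝕜] [RCLike 𝕜'] [NormedAddCommGroup E] [NormedSpace 𝕜 E]
  [NormedSpace ℝ E] [IsScalarTower ℝ 𝕜 E] [CompleteSpace E] [NormedAddCommGroup F]
  [NormedSpace 𝕜' F] [NormedSpace ℝ F] [IsScalarTower ℝ 𝕜' F] [CompleteSpace F]

theorem map_perturb_apply {S : ContractionSemigroup 𝕜 E} {S' : ContractionSemigroup 𝕜' F}
    {K : E →L[𝕜] E} {K' : F →L[𝕜'] F} (J : E →L[ℝ] F) (hS : ∀ t x, J (S t x) = S' t (J x))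
    (hK : ∀ x, J (K x) = K' (J x)) {t : ℝ} (ht : 0 ≤ t) (x : E) :
    J (S.perturb K t x) = S'.perturb K' t (J x) := by
  have hcont := (S.perturb K).continuous_orbit x
  refine S'.eq_perturb K' (y := fun t => J (S.perturb K t x)) (J.continuous.comp hcont)
    (fun t ⟨ht, _⟩ => ?_) ht
  rw [S.perturb_eq K ht, map_add, hS, ← ContinuousLinearMap.intervalIntegral_comp_comm _
    ((S.continuous_duhamel K hcont t).intervalIntegrable _ _)]
  simp only [hS, hK]

end Intertwining

variable {𝕜 E : Type*} [RCLike 𝕜] [NormedAddCommGroup E] [NormedSpace 𝕜 E]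
  [NormedSpace ℝ E] [IsScalarTower ℝ 𝕜 E] [CompleteSpace E] (S : ContractionSemigroup 𝕜 E)
  {K : E →L[𝕜] E}

theorem hasGeneratorAt_perturb_iff (K : E →L[𝕜] E) {x g : E} :
    (S.perturb K).HasGeneratorAt x (g + K x) ↔ S.HasGeneratorAt x g := by
  have hduhamel := hasDerivAt_integral_diagonal_zero
    (F := fun t s => S (t - s) (K (S.perturb K s x)))
    (S.continuous_uncurry_duhamel K ((S.perturb K).continuous_orbit x))
  rw [sub_zero, S.zero_apply, C0Semigroup.zero_apply] at hduhamel
  refine ⟨fun h => ?_, fun h => (HasDerivWithinAt.add h hduhamel.hasDerivWithinAt).congr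
    (fun t ht => S.perturb_eq K ht x) (S.perturb_eq K le_rfl x)⟩
  have hsub := HasDerivWithinAt.sub h hduhamel.hasDerivWithinAt
  rw [add_sub_cancel_right] at hsub
  exact hsub.congr (fun t ht => eq_sub_of_add_eq (S.perturb_eq K ht x).symm)
    (eq_sub_of_add_eq (S.perturb_eq K le_rfl x).symm)

open scoped Pointwise in
/-- On the unit ball the integrand of Duhamel's formula takes its values in a compact set, and so
does its average. -/
theorem isCompactOperator_perturb_sub (hK : IsCompactOperator K) {t : ℝ} (ht : 0 ≤ t) :
    IsCompactOperator (S.perturb K t - S t) := by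
  rcases ht.eq_or_lt with rfl | htpos
  · rw [show S.perturb K 0 - S 0 = 0 by
      ext x; simp [S.zero_apply, C0Semigroup.zero_apply]]
    exact isCompactOperator_zero
  obtain ⟨M, hM⟩ := (S.perturb K).exists_norm_le 0 t
  obtain ⟨Q, hQ, hKQ⟩ := hK.image_closedBall_subset_compact (f := K.toLinearMap) M
  set R := (fun p : ℝ × E => S p.1 p.2) '' Icc 0 t ×ˢ Q
  set C := closure (convexHull ℝ R)
  have hC : IsCompact C := ((isCompact_Icc.prod hQ).image S.continuous_uncurry).totallyBounded
    |>.convexHull.closure.isCompact_of_isClosed isClosed_closure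
  have hmem : ∀ x ∈ Metric.closedBall (0 : E) 1, ∀ s ∈ Ioc 0 t,
      S (t - s) (K (S.perturb K s x)) ∈ C := fun x hx s hs => by
    refine subset_closure (subset_convexHull ℝ R ⟨(t - s, K (S.perturb K s x)),
      ⟨⟨sub_nonneg.2 hs.2, sub_le_self _ hs.1.le⟩, hKQ ⟨S.perturb K s x, ?_, rfl⟩⟩, rfl⟩)
    exact mem_closedBall_zero_iff.2 <| ((S.perturb K s).le_of_opNorm_le_of_le
      (hM s (Ioc_subset_Icc_self hs)) (mem_closedBall_zero_iff.1 hx)).trans (mul_one M).le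
  refine (isCompactOperator_iff_image_closedBall_subset_compact
    (S.perturb K t - S t).toLinearMap one_pos).2 ⟨(t - 0) • C, hC.smul _, ?_⟩
  rintro _ ⟨x, hx, rfl⟩
  change S.perturb K t x - S t x ∈ _
  rw [S.perturb_eq K ht, add_sub_cancel_left]
  exact intervalIntegral_mem_smul_of_convex (convex_convexHull ℝ R).closure isClosed_closure htpos
    ((S.continuous_duhamel K ((S.perturb K).continuous_orbit x) t).intervalIntegrable _ _)
    (hmem x hx)

end ContractionSemigroup

namespace C0Semigroup

section Generator

variable {𝕜 E : Type*} [RCLike 𝕜] [NormedAddCommGroup E] [NormedSpace 𝕜 E] [NormedSpace ℝ E]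

theorem norm_integral_orbit_le {S : C0Semigroup 𝕜 E} {M a b : ℝ}
    (hM : ∀ t ∈ uIcc a b, ‖S t‖ ≤ M) (x : E) : ‖∫ s in a..b, S s x‖ ≤ M * |b - a| * ‖x‖ := by
  rw [mul_right_comm]
  exact intervalIntegral.norm_integral_le_of_norm_le_const fun s hs =>
    (S s).le_of_opNorm_le (hM s (uIoc_subset_uIcc hs)) x

variable [CompleteSpace E]

theorem apply_integral_orbit (S : C0Semigroup 𝕜 E) (x : E) {t a b : ℝ} (ht : 0 ≤ t) (ha : 0 ≤ a)
    (hb : 0 ≤ b) : S t (∫ s in a..b, S s x) = ∫ s in a + t..b + t, S s x := by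
  rw [← ContinuousLinearMap.intervalIntegral_comp_comm _
    ((S.continuous_orbit x).intervalIntegrable a b), ← intervalIntegral.integral_comp_add_right]
  refine intervalIntegral.integral_congr fun s hs => ?_
  simp only [add_comm s t, S.add_apply ht ((le_min ha hb).trans hs.1)]

theorem tendsto_inv_smul_integral_orbit (S : C0Semigroup 𝕜 E) (x : E) :
    Tendsto (fun ε : ℝ => ε⁻¹ • ∫ s in (0 : ℝ)..ε, S s x) (𝓝[>] 0) (𝓝 x) := by
  have hcont := S.continuous_orbit x
  have hprim : HasDerivAt (fun t => ∫ s in (0 : ℝ)..t, S s x) (S 0 x) 0 :=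
    intervalIntegral.integral_hasDerivAt_right (hcont.intervalIntegrable _ _)
      (hcont.stronglyMeasurableAtFilter _ _) hcont.continuousAt
  rw [S.zero_apply] at hprim
  simpa using hprim.tendsto_slope_zero_right

theorem hasGeneratorAt_integral_orbit (S : C0Semigroup 𝕜 E) (x : E) {ε : ℝ} (hε : 0 ≤ ε) :
    S.HasGeneratorAt (∫ s in (0 : ℝ)..ε, S s x) (S ε x - x) := by
  have hcont := S.continuous_orbit x
  have hprim (r : ℝ) : HasDerivAt (fun t => ∫ s in (0 : ℝ)..t, S s x) (S r x) r :=
    intervalIntegral.integral_hasDerivAt_right (hcont.intervalIntegrable _ _)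
      (hcont.stronglyMeasurableAtFilter _ _) hcont.continuousAt
  have hderiv := ((hprim (ε + 0)).comp_const_add ε 0).sub (hprim 0)
  rw [add_zero, S.zero_apply] at hderiv
  have heq : ∀ t, 0 ≤ t → S t (∫ s in (0 : ℝ)..ε, S s x)
      = (∫ s in (0 : ℝ)..ε + t, S s x) - ∫ s in (0 : ℝ)..t, S s x := fun t ht => by
    rw [S.apply_integral_orbit x ht le_rfl hε, zero_add,
      intervalIntegral.integral_interval_sub_left]
    exacts [hcont.intervalIntegrable _ _, hcont.intervalIntegrable _ _]
  exact hderiv.hasDerivWithinAt.congr heq (heq 0 le_rfl)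

variable [IsScalarTower ℝ 𝕜 E] {S : C0Semigroup 𝕜 E} {x g : E}

theorem HasGeneratorAt.hasDerivWithinAt_Ici_zero (hx : S.HasGeneratorAt x g) {t : ℝ}
    (ht : 0 ≤ t) : HasDerivWithinAt (fun s => S s x) (S t g) (Ici 0) t := by
  have hcont := S.continuous_orbit g
  have hderiv : HasDerivAt (fun s => x + ∫ r in (0 : ℝ)..s, S r g) (S t g) t :=
    (intervalIntegral.integral_hasDerivAt_right (hcont.intervalIntegrable _ _)
      (hcont.stronglyMeasurableAtFilter _ _) hcont.continuousAt).const_add x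
  have heq : ∀ s, 0 ≤ s → S s x = x + ∫ r in (0 : ℝ)..s, S r g := fun s hs => by
    rw [hx.integral_eq_sub le_rfl hs, S.zero_apply, add_sub_cancel]
  exact hderiv.hasDerivWithinAt.congr heq (heq t ht)

theorem dense_setOf_hasGeneratorAt (S : C0Semigroup 𝕜 E) :
    Dense {x | ∃ g, S.HasGeneratorAt x g} := fun x => by
  refine mem_closure_of_tendsto (S.tendsto_inv_smul_integral_orbit x) ?_
  filter_upwards [self_mem_nhdsWithin] with ε (hε : 0 < ε)
  exact ⟨_, ((S.hasGeneratorAt_integral_orbit x hε.le).const_smul ε⁻¹).congr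
    (fun t _ => (S t).map_smul_of_tower _ _) ((S 0).map_smul_of_tower _ _)⟩

end Generator

noncomputable section Adjoint

variable {𝕜 H : Type*} [RCLike 𝕜] [NormedAddCommGroup H] [InnerProductSpace 𝕜 H]
  [NormedSpace ℝ H] [IsScalarTower ℝ 𝕜 H] [CompleteSpace H] (S : C0Semigroup 𝕜 H)

/-- The strong integral `∫₀ᵗ S(s) ds`, as a bounded operator. -/
def integralCLM (t : ℝ) : H →L[𝕜] H :=
  LinearMap.mkContinuousOfExistsBound
    { toFun := fun x => ∫ s in (0 : ℝ)..t, S s x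
      map_add' := fun x y => by
        simp only [map_add]
        exact intervalIntegral.integral_add ((S.continuous_orbit x).intervalIntegrable _ _)
          ((S.continuous_orbit y).intervalIntegrable _ _)
      map_smul' := fun a x => by
        simp only [map_smul, RingHom.id_apply, intervalIntegral.integral_smul] } <| by
    obtain ⟨M, hM⟩ := S.exists_norm_le (min 0 t) (max 0 t)
    exact ⟨M * |t - 0|, norm_integral_orbit_le hM⟩

theorem integralCLM_apply (t : ℝ) (x : H) : S.integralCLM t x = ∫ s in (0 : ℝ)..t, S s x := rfl

theorem continuous_integralCLM : Continuous S.integralCLM := by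
  refine continuous_iff_continuousAt.2 fun t => ?_
  obtain ⟨M, hM⟩ := S.exists_norm_le (t - 1) (t + 1)
  have ht : t ∈ Icc (t - 1) (t + 1) := by constructor <;> linarith
  have hlip : LipschitzOnWith M.toNNReal S.integralCLM (Icc (t - 1) (t + 1)) := by
    refine LipschitzOnWith.of_dist_le_mul fun a ha b hb => ?_
    have hM0 : 0 ≤ M := (norm_nonneg _).trans (hM t ht)
    rw [dist_eq_norm, dist_eq_norm, Real.coe_toNNReal _ hM0]
    refine ContinuousLinearMap.opNorm_le_bound _ (by positivity) fun x => ?_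
    rw [sub_apply, integralCLM_apply, integralCLM_apply,
      intervalIntegral.integral_interval_sub_left
        ((S.continuous_orbit x).intervalIntegrable _ _)
        ((S.continuous_orbit x).intervalIntegrable _ _)]
    exact norm_integral_orbit_le (fun s hs => hM s (uIcc_subset_Icc hb ha hs)) x
  exact hlip.continuousOn.continuousAt (Icc_mem_nhds (by linarith) (by linarith))

theorem integralCLM_comp {t ε : ℝ} (ht : 0 ≤ t) (hε : 0 ≤ ε) :
    S.integralCLM ε ∘L S t = S.integralCLM (ε + t) - S.integralCLM t := by
  ext x
  have hcont := S.continuous_orbit x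
  rw [ContinuousLinearMap.comp_apply, sub_apply, integralCLM_apply,
    integralCLM_apply, integralCLM_apply, intervalIntegral.integral_interval_sub_left
      (hcont.intervalIntegrable _ _) (hcont.intervalIntegrable _ _)]
  have hshift := intervalIntegral.integral_comp_add_right (fun s => S s x) t (a := 0) (b := ε)
  rw [zero_add] at hshift
  rw [← hshift]
  refine intervalIntegral.integral_congr fun s hs => ?_
  exact (S.add_apply ((le_min le_rfl hε).trans hs.1) ht x).symm

theorem dense_span_range_adjoint_integralCLM :
    Dense (Submodule.span 𝕜 {v : H | ∃ ε ≥ 0, ∃ w, (S.integralCLM ε).adjoint w = v} : Set H) := by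
  rw [Submodule.dense_iff_topologicalClosure_eq_top,
    Submodule.topologicalClosure_eq_top_iff, Submodule.eq_bot_iff]
  intro x hx
  have hzero : ∀ ε ≥ 0, ∫ s in (0 : ℝ)..ε, S s x = 0 := fun ε hε =>
    ext_inner_left 𝕜 fun w => by
      rw [← integralCLM_apply, ← ContinuousLinearMap.adjoint_inner_left, inner_zero_right]
      exact hx _ (Submodule.subset_span ⟨ε, hε, w, rfl⟩)
  refine tendsto_nhds_unique ((S.tendsto_inv_smul_integral_orbit x).congr' ?_) tendsto_const_nhds
  filter_upwards [self_mem_nhdsWithin] with ε hε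
  rw [hzero ε (le_of_lt hε), smul_zero]

theorem continuous_adjoint_orbit_of_mem_span {v : H}
    (hv : v ∈ Submodule.span 𝕜 {v : H | ∃ ε ≥ 0, ∃ w, (S.integralCLM ε).adjoint w = v}) :
    Continuous fun t : ℝ => (S (max t 0)).adjoint v := by
  induction hv using Submodule.span_induction with
  | mem v hv =>
    obtain ⟨ε, hε, w, rfl⟩ := hv
    have heq (t : ℝ) : (S (max t 0)).adjoint ((S.integralCLM ε).adjoint w)
        = (S.integralCLM (ε + max t 0) - S.integralCLM (max t 0)).adjoint w := by
      rw [← S.integralCLM_comp (le_max_right t 0) hε, ContinuousLinearMap.adjoint_comp,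
        ContinuousLinearMap.comp_apply]
    simp only [heq]
    have hI := S.continuous_integralCLM
    have hmax : Continuous fun t : ℝ => max t 0 := continuous_id.max continuous_const
    exact (ContinuousLinearMap.adjoint.continuous.comp
      ((hI.comp (continuous_const.add hmax)).sub (hI.comp hmax))).clm_apply continuous_const
  | zero => simp only [map_zero, continuous_const]
  | add v w _ _ hv hw =>
    simp only [map_add]
    exact hv.add hw
  | smul a v _ hv =>
    simp only [map_smul]
    exact hv.const_smul a

theorem continuous_adjoint_orbit (v : H) :
    Continuous fun t : ℝ => (S (max t 0)).adjoint v := by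
  refine continuous_of_locally_uniform_approx_of_continuousAt fun t u hu => ?_
  obtain ⟨δ, hδ, hu⟩ := Metric.mem_uniformity_dist.1 hu
  obtain ⟨M, hM⟩ := S.exists_norm_le 0 (max (t + 1) 0)
  have hM0 : 0 ≤ M := (norm_nonneg _).trans (hM 0 (left_mem_Icc.2 (le_max_right _ _)))
  obtain ⟨w, hw, hvw⟩ := S.dense_span_range_adjoint_integralCLM.exists_dist_lt v
    (ε := δ / (M + 1)) (by positivity)
  refine ⟨Iic (t + 1), Iic_mem_nhds (lt_add_one t), _,
    (S.continuous_adjoint_orbit_of_mem_span hw).continuousAt, fun s hs => hu ?_⟩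
  rw [dist_eq_norm, ← map_sub]
  calc ‖(S (max s 0)).adjoint (v - w)‖ ≤ M * ‖v - w‖ :=
        ContinuousLinearMap.le_of_opNorm_le _
          ((ContinuousLinearMap.adjoint.norm_map _).trans_le
            (hM _ ⟨le_max_right _ _, max_le_max_right _ hs⟩)) _
    _ ≤ (M + 1) * dist v w := by
        rw [dist_eq_norm]
        exact mul_le_mul_of_nonneg_right (by linarith) (norm_nonneg _)
    _ < δ := by rwa [lt_div_iff₀' (by positivity)] at hvw

/-- The adjoint semigroup, which on a Hilbert space is again strongly continuous. The negative
times carry no information and are sent to the operator at time `0`. -/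
def adjoint : C0Semigroup 𝕜 H where
  toFun t := (S (max t 0)).adjoint
  map_zero' x := ext_inner_right 𝕜 fun v => by
    rw [max_self, ContinuousLinearMap.adjoint_inner_left, S.zero_apply]
  map_add' s t hs ht x := ext_inner_right 𝕜 fun v => by
    simp only [ContinuousLinearMap.adjoint_inner_left, max_eq_left, hs, ht, add_nonneg,
      add_comm s t, S.add_apply]
  continuous_orbit' := S.continuous_adjoint_orbit

theorem adjoint_apply {t : ℝ} (ht : 0 ≤ t) : S.adjoint t = (S t).adjoint := by
  change (S (max t 0)).adjoint = _
  rw [max_eq_left ht]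

end Adjoint

end C0Semigroup

namespace C0Semigroup

variable {𝕜 H : Type*} [RCLike 𝕜] [NormedAddCommGroup H] [InnerProductSpace 𝕜 H]
  [NormedSpace ℝ H] [IsScalarTower ℝ 𝕜 H] [CompleteSpace H] {S : C0Semigroup 𝕜 H}
  {A : H →ₗ.[𝕜] H} {z g : H}

theorem HasGeneratorAt.inner_eq_of_adjoint (hz : S.adjoint.HasGeneratorAt z g) {x h : H}
    (hx : S.HasGeneratorAt x h) : ⟪g, x⟫_𝕜 = ⟪z, h⟫_𝕜 := by
  have hleft := HasDerivWithinAt.inner 𝕜 hz (hasDerivWithinAt_const (0 : ℝ) (Ici 0) x)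
  have hright := HasDerivWithinAt.inner 𝕜 (hasDerivWithinAt_const (0 : ℝ) (Ici 0) z) hx
  simp only [inner_zero_left, inner_zero_right, add_zero, zero_add] at hleft hright
  refine (uniqueDiffWithinAt_Ici (0 : ℝ)).eq_deriv _ hleft (hright.congr (fun t ht => ?_) ?_)
  · rw [S.adjoint_apply ht, ContinuousLinearMap.adjoint_inner_left]
  · rw [S.adjoint_apply le_rfl, ContinuousLinearMap.adjoint_inner_left]

theorem exists_adjoint_apply_eq (hA : Dense (A.domain : Set H))
    (hS : ∀ y : A.domain, S.HasGeneratorAt y (A y)) (hz : S.adjoint.HasGeneratorAt z g) :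
    ∃ hz : z ∈ A†.domain, A† ⟨z, hz⟩ = g := by
  have hinner (y : A.domain) : ⟪g, (y : H)⟫_𝕜 = ⟪z, A y⟫_𝕜 := hz.inner_eq_of_adjoint (hS y)
  exact ⟨LinearPMap.mem_adjoint_domain_of_exists _ ⟨g, hinner⟩,
    LinearPMap.adjoint_apply_eq hA _ hinner⟩

theorem exists_isAdjointSolution (hA : Dense (A.domain : Set H))
    (hS : ∀ y : A.domain, S.HasGeneratorAt y (A y)) (hz : S.adjoint.HasGeneratorAt z g) (τ : ℝ) :
    ∃ ζ : ℝ → A†.domain, IsAdjointSolution A τ ζ ∧ (ζ τ : H) = z := by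
  have hmax (t : ℝ) : 0 ≤ max (τ - t) 0 := le_max_right _ _
  have hadj (t : ℝ) := exists_adjoint_apply_eq hA hS (hz.apply (hmax t))
  choose hmem hval using hadj
  have heq : ∀ t ∈ Icc 0 τ, S.adjoint (max (τ - t) 0) z = S.adjoint (τ - t) z := fun t ht => by
    rw [max_eq_left (sub_nonneg.2 ht.2)]
  refine ⟨fun t => ⟨S.adjoint (max (τ - t) 0) z, hmem t⟩, ⟨fun t ht => ?_, ?_⟩, ?_⟩
  · rw [hval t, max_eq_left (sub_nonneg.2 ht.2)]
    have hderiv := (hz.hasDerivWithinAt_Ici_zero (sub_nonneg.2 ht.2)).scomp t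
      ((hasDerivWithinAt_id t (Icc 0 τ)).const_sub τ) fun s hs => sub_nonneg.2 hs.2
    rw [neg_one_smul] at hderiv
    exact hderiv.congr heq (heq t ht)
  · simp only [hval]
    exact ((S.adjoint.continuous_orbit g).comp
      ((continuous_const.sub continuous_id).max continuous_const)).continuousOn
  · simp only [sub_self, max_self, S.adjoint.zero_apply]

theorem eqOn_of_isTranspositionSolution {U : Type*} [NormedAddCommGroup U]
    [InnerProductSpace 𝕜 U] (hA : Dense (A.domain : Set H))
    (hS : ∀ y : A.domain, S.HasGeneratorAt y (A y)) {Bs : A†.domain → U} {T : ℝ} {y₀ : H}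
    {u : ℝ → U} {y₁ y₂ : ℝ → H} (h₁ : IsTranspositionSolution A Bs T y₀ u y₁)
    (h₂ : IsTranspositionSolution A Bs T y₀ u y₂) : EqOn y₁ y₂ (Icc 0 T) := fun τ hτ => by
  refine S.adjoint.dense_setOf_hasGeneratorAt.eq_of_inner_right 𝕜 fun z hz => ?_
  obtain ⟨g, hz⟩ := hz
  obtain ⟨ζ, hζ, rfl⟩ := exists_isAdjointSolution hA hS hz τ
  exact sub_left_injective ((h₁.2 τ hτ ζ hζ).trans (h₂.2 τ hτ ζ hζ).symm)

end C0Semigroup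

namespace C0Semigroup

section FiniteDimensional

variable {𝕜 E : Type*} [RCLike 𝕜] [NormedAddCommGroup E] [NormedSpace 𝕜 E]
  [NormedSpace ℝ E] [IsScalarTower ℝ 𝕜 E] {S : C0Semigroup 𝕜 E} {N : Submodule 𝕜 E}
  [FiniteDimensional 𝕜 N]

theorem HasGeneratorAt.mem_of_invariant {δ : ℝ} (hδ : 0 < δ)
    (hN : ∀ s ∈ Icc 0 δ, ∀ z ∈ N, S s z ∈ N)
    {z g : E} (hz : z ∈ N) (hg : S.HasGeneratorAt z g) : g ∈ N := by
  have hslope := (hasDerivWithinAt_iff_tendsto_slope' self_notMem_Ioi).1 hg.Ioi_of_Ici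
  refine N.closed_of_finiteDimensional.mem_of_tendsto hslope ?_
  filter_upwards [Ioc_mem_nhdsGT hδ] with s hs
  rw [slope_def_module, S.zero_apply]
  exact N.smul_of_tower_mem _ (N.sub_mem (hN s (Ioc_subset_Icc_self hs) z hz) hz)

variable [CompleteSpace E]

theorem exists_hasGeneratorAt_of_invariant {δ : ℝ} (hδ : 0 < δ)
    (hN : ∀ s ∈ Icc 0 δ, ∀ z ∈ N, S s z ∈ N) {z : E}
    (hz : z ∈ N) : ∃ g ∈ N, S.HasGeneratorAt z g := by
  let D : Submodule 𝕜 E :=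
    { carrier := {z | z ∈ N ∧ ∃ g, S.HasGeneratorAt z g}
      zero_mem' := ⟨N.zero_mem, 0, by
        simpa only [HasGeneratorAt, map_zero] using hasDerivWithinAt_const _ _ _⟩
      add_mem' := fun ⟨hx, g, hg⟩ ⟨hy, h, hh⟩ => ⟨N.add_mem hx hy, g + h,
        (HasDerivWithinAt.add hg hh).congr (fun _ _ => map_add _ _ _) (map_add _ _ _)⟩
      smul_mem' := fun a x ⟨hx, g, hg⟩ => ⟨N.smul_mem a hx, a • g,
        (HasDerivWithinAt.const_smul a hg).congr (fun _ _ => map_smul _ _ _) (map_smul _ _ _)⟩ }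
  have hDN : D ≤ N := fun x hx => hx.1
  have : FiniteDimensional 𝕜 D := Submodule.finiteDimensional_of_le hDN
  have hmem : z ∈ D := by
    refine D.closed_of_finiteDimensional.mem_of_tendsto (S.tendsto_inv_smul_integral_orbit z) ?_
    filter_upwards [Ioc_mem_nhdsGT hδ] with ε hε
    have hint := S.hasGeneratorAt_integral_orbit z hε.1.le
    have hmem : ∫ s in (0 : ℝ)..ε, S s z ∈ N := by
      obtain ⟨c, hc, h⟩ := intervalIntegral_mem_smul_of_convex (N.restrictScalars ℝ).convex
        N.closed_of_finiteDimensional hε.1 ((S.continuous_orbit z).intervalIntegrable _ _)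
        fun s hs => hN s ⟨hs.1.le, hs.2.trans hε.2⟩ z hz
      exact h ▸ N.smul_of_tower_mem _ hc
    exact D.smul_of_tower_mem _ ⟨hmem, _, hint⟩
  obtain ⟨-, g, hg⟩ := hmem
  exact ⟨g, hg.mem_of_invariant hδ hN hz, hg⟩

end FiniteDimensional

variable {H : Type*} [NormedAddCommGroup H] [InnerProductSpace ℂ H] [CompleteSpace H]
  {S : C0Semigroup ℂ H} {A : H →ₗ.[ℂ] H}

theorem exists_eigenvector_adjoint_of_invariant (hA : Dense (A.domain : Set H))
    (hS : ∀ y : A.domain, S.HasGeneratorAt y (A y)) {N : Submodule ℂ H} [FiniteDimensional ℂ N]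
    (hN0 : N ≠ ⊥) {δ : ℝ} (hδ : 0 < δ) (hN : ∀ s ∈ Icc 0 δ, ∀ z ∈ N, S.adjoint s z ∈ N) :
    ∃ z : A†.domain, (z : H) ∈ N ∧ z ≠ 0 ∧ ∃ lam : ℂ, A† z = lam • (z : H) := by
  have hgen : ∀ z ∈ N, ∃ hz : z ∈ A†.domain, A† ⟨z, hz⟩ ∈ N := fun z hz => by
    obtain ⟨g, hg, hgz⟩ := S.adjoint.exists_hasGeneratorAt_of_invariant hδ hN hz
    obtain ⟨hz, rfl⟩ := exists_adjoint_apply_eq hA hS hgz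
    exact ⟨hz, hg⟩
  have hdom : N ≤ A†.domain := fun z hz => (hgen z hz).1
  let φ : Module.End ℂ N := (A†.toFun ∘ₗ Submodule.inclusion hdom).codRestrict N
    fun z => (hgen z z.2).2
  have : Nontrivial N := (Submodule.nontrivial_iff_ne_bot).2 hN0
  obtain ⟨lam, hlam⟩ := Module.End.exists_eigenvalue φ
  obtain ⟨z, hz⟩ := hlam.exists_hasEigenvector
  refine ⟨Submodule.inclusion hdom z, z.2, fun h => hz.2 ?_, lam, ?_⟩
  · exact Subtype.ext (Subtype.ext_iff.1 h : (z : H) = 0)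
  · exact congr_arg Subtype.val hz.apply_eq_smul

theorem exists_eigenvector_adjoint_of_orthogonal_ne_bot (hA : Dense (A.domain : Set H))
    (hS : ∀ y : A.domain, S.HasGeneratorAt y (A y)) {R : ℝ → Submodule ℂ H} {a b : ℝ}
    (hab : a < b) (hR : MonotoneOn R (Ici a))
    (hSR : ∀ s ≥ 0, ∀ t ≥ a, ∀ x ∈ R t, S s x ∈ R (s + t))
    (hfin : ∀ t ≥ a, FiniteDimensional ℂ (R t)ᗮ) (hb : (R b)ᗮ ≠ ⊥) :
    ∃ t ≥ a, ∃ z : A†.domain, (z : H) ∈ (R t)ᗮ ∧ z ≠ 0 ∧ ∃ lam : ℂ, A† z = lam • (z : H) := by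
  obtain ⟨s, t, has, hst, htb, heq⟩ : ∃ s t, a ≤ s ∧ s < t ∧ t ≤ b ∧ (R s)ᗮ = (R t)ᗮ := by
    obtain ⟨u, hu, hmem, -⟩ := exists_seq_strictMono_tendsto' hab
    by_contra! hne
    refine not_strictAnti_of_wellFoundedLT (fun n => Module.finrank ℂ (R (u n))ᗮ)
      (strictAnti_nat_of_succ_lt fun n => ?_)
    have := hfin (u n) (hmem n).1.le
    have hle : R (u n) ≤ R (u (n + 1)) :=
      hR (hmem n).1.le (hmem (n + 1)).1.le (hu.monotone n.le_succ)
    exact Submodule.finrank_lt_finrank_of_lt <| (Submodule.orthogonal_le hle).lt_of_ne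
      (hne _ _ (hmem n).1.le (hu n.lt_succ_self) (hmem (n + 1)).2.le).symm
  have := hfin s has
  have hne : (R s)ᗮ ≠ ⊥ := ne_bot_of_le_ne_bot hb
    (Submodule.orthogonal_le (hR has hab.le (hst.le.trans htb)))
  refine ⟨s, has, exists_eigenvector_adjoint_of_invariant hA hS hne (sub_pos.2 hst)
    fun r hr z hz x hx => ?_⟩
  rw [S.adjoint_apply hr.1, ContinuousLinearMap.adjoint_inner_right]
  rw [heq] at hz
  have hrs : r + s ≤ t := le_sub_iff_add_le.1 hr.2
  exact hz _ (hR (has.trans (le_add_of_nonneg_left hr.1)) (has.trans hst.le) hrs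
    (hSR r hr.1 s has x hx))

end C0Semigroup

section Eigenvector

variable {H U : Type*} [NormedAddCommGroup H] [InnerProductSpace ℂ H] [CompleteSpace H]
  [NormedAddCommGroup U] [InnerProductSpace ℂ U] {A : H →ₗ.[ℂ] H} {lam : ℂ} {z : A†.domain}

theorem isAdjointSolution_exp_smul (hz : A† z = lam • (z : H)) (τ : ℝ) :
    IsAdjointSolution A τ fun t => Complex.exp (lam * (τ - t : ℝ)) • z := by
  have hval (t : ℝ) : A† (Complex.exp (lam * (τ - t : ℝ)) • z)
      = (lam * Complex.exp (lam * (τ - t : ℝ))) • (z : H) := by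
    rw [LinearPMap.map_smul, hz, smul_smul, mul_comm]
  refine ⟨fun t _ => ?_, ?_⟩
  · have hlin : HasDerivAt (fun t : ℝ => lam * (τ - t : ℝ)) (lam * (-1 : ℝ)) t :=
      (((hasDerivAt_id t).const_sub τ).ofReal_comp).const_mul lam
    have hderiv := (hlin.cexp.smul_const (z : H)).hasDerivWithinAt (s := Icc 0 τ)
    rw [Complex.ofReal_neg, Complex.ofReal_one, mul_neg_one, mul_neg, mul_comm, neg_smul,
      ← hval] at hderiv
    exact hderiv
  · simp only [hval]
    fun_prop

theorem ApproximatelyControllable.fattoriniCriterion {Bs : A†.domain → U} {T : ℝ} (hT : 0 ≤ T)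
    (hBs : ∀ (a : ℂ) (z : A†.domain), Bs (a • z) = a • Bs z)
    (h : ApproximatelyControllable A Bs T) : FattoriniCriterion A Bs := by
  intro lam z hz hBz
  by_contra hne
  have hpos : 0 < ‖(z : H)‖ := norm_pos_iff.2 fun h => hne (Subtype.ext h)
  obtain ⟨u, -, y, hy, hyT⟩ := h (‖(z : H)‖ / 2) (half_pos hpos) 0 z
  have hpair := hy.2 T ⟨hT, le_rfl⟩ _ (isAdjointSolution_exp_smul hz T)
  have horth : ⟪(z : H), y T⟫_ℂ = 0 := by
    simpa [hBs, hBz] using hpair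
  have hle : ‖(z : H)‖ ≤ ‖y T - z‖ := by
    have hcs := norm_inner_le_norm (𝕜 := ℂ) (z : H) (y T - z)
    rw [inner_sub_right, horth, zero_sub, norm_neg, inner_self_eq_norm_sq_to_K, norm_pow,
      RCLike.norm_ofReal, abs_norm, sq] at hcs
    exact le_of_mul_le_mul_left hcs hpos
  linarith

theorem eigenvector_controlAdjoint_eq_zero {Bs : A†.domain → U} {T : ℝ} (hT : 0 < T)
    (hBs : ∀ (a : ℂ) (z : A†.domain), Bs (a • z) = a • Bs z) (hz : A† z = lam • (z : H))
    {y : ℝ → H} (hy : IsTranspositionSolution A Bs T 0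
      (fun t => Complex.exp (lam * (T - t : ℝ)) • Bs z) y) (hyz : ⟪(z : H), y T⟫_ℂ = 0) :
    Bs z = 0 := by
  by_contra hne
  have hpair := hy.2 T ⟨hT.le, le_rfl⟩ _ (isAdjointSolution_exp_smul hz T)
  simp only [hBs, Submodule.coe_smul, inner_smul_left (z : H) (y T), hyz, mul_zero,
    inner_zero_right, sub_zero, inner_self_eq_norm_sq_to_K, Complex.coe_algebraMap,
    ← Complex.ofReal_pow, intervalIntegral.integral_ofReal] at hpair
  refine (intervalIntegral.intervalIntegral_pos_of_pos (Continuous.intervalIntegrable ?_ _ _)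
    (fun t => ?_) hT).ne (Complex.ofReal_eq_zero.1 hpair.symm).symm
  · fun_prop
  · exact pow_pos (norm_pos_iff.2 (smul_ne_zero (Complex.exp_ne_zero _) hne)) 2

end Eigenvector

namespace IntegralTransport

noncomputable section

/-- The space `L²(ℝ; 𝕜)`, in which the boundary control is encoded as the part of the initial
datum beyond `x = L`. -/
abbrev L2R (𝕜 : Type*) [RCLike 𝕜] : Type _ := Lp 𝕜 2 (volume : Measure ℝ)

variable {𝕜 : Type*} [RCLike 𝕜]

theorem locallyIntegrable_coe (w : L2R 𝕜) : LocallyIntegrable w :=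
  (Lp.memLp w).locallyIntegrable (by norm_num)

theorem intervalIntegrable_coe (w : L2R 𝕜) (a b : ℝ) : IntervalIntegrable w volume a b :=
  ((locallyIntegrable_coe w).integrableOn_isCompact isCompact_uIcc).intervalIntegrable

theorem compMeasurePreserving_add (s t : ℝ) (w : L2R 𝕜) :
    Lp.compMeasurePreserving (fun x => s + t + x) (measurePreserving_add_left volume (s + t)) w
      = Lp.compMeasurePreserving (fun x => s + x) (measurePreserving_add_left volume s)
        (Lp.compMeasurePreserving (fun x => t + x) (measurePreserving_add_left volume t) w) := by
  have h := add_vadd (DomAddAct.mk s) (DomAddAct.mk t) w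
  rwa [← DomAddAct.mk_add, add_comm t s] at h

variable (𝕜) in
/-- The semigroup of left translations `(shift t w)(x) = w(t + x)` on `L²(ℝ)`. -/
def shift : ContractionSemigroup 𝕜 (L2R 𝕜) where
  toFun t := (Lp.compMeasurePreservingₗᵢ 𝕜 (fun x => t + x)
    (measurePreserving_add_left volume t)).toContinuousLinearMap
  map_zero' := zero_vadd ℝᵈᵃᵃ
  map_add' s t _ _ := compMeasurePreserving_add s t
  continuous_orbit' _ :=
    have : Fact ((2 : ℝ≥0∞) ≠ ⊤) := ⟨ENNReal.ofNat_ne_top⟩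
    DomAddAct.continuous_mk.vadd continuous_const
  norm_apply_le' _ w := (LinearIsometry.norm_map _ w).le

theorem coeFn_shift (t : ℝ) (w : L2R 𝕜) : shift 𝕜 t w =ᵐ[volume] fun x => w (t + x) :=
  Lp.coeFn_compMeasurePreserving w (measurePreserving_add_left volume t)

theorem shift_shift (s t : ℝ) (w : L2R 𝕜) : shift 𝕜 s (shift 𝕜 t w) = shift 𝕜 (s + t) w :=
  (compMeasurePreserving_add s t w).symm

theorem shift_zero (w : L2R 𝕜) : shift 𝕜 0 w = w := (shift 𝕜).zero_apply w

theorem inner_shift_left (t : ℝ) (v w : L2R 𝕜) :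
    ⟪shift 𝕜 t v, w⟫_𝕜 = ⟪v, shift 𝕜 (-t) w⟫_𝕜 := by
  nth_rw 1 [← shift_zero w, ← add_neg_cancel t, ← shift_shift]
  exact LinearIsometry.inner_map_map _ _ _

section Vanishing

variable (𝕜) in
/-- The functions in `L²(ℝ)` which vanish almost everywhere on `s`. -/
def vanishingOn (s : Set ℝ) : Submodule 𝕜 (L2R 𝕜) :=
  LinearMap.ker (LpToLpRestrictCLM ℝ 𝕜 𝕜 volume 2 s).toLinearMap

variable {s t : Set ℝ} {w : L2R 𝕜}

theorem mem_vanishingOn_iff : w ∈ vanishingOn 𝕜 s ↔ w =ᵐ[volume.restrict s] 0 := by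
  have hcoe := LpToLpRestrictCLM_coeFn (p := 2) 𝕜 s w
  refine LinearMap.mem_ker.trans ((Lp.eq_zero_iff_ae_eq_zero (E := 𝕜) (p := 2)).trans ?_)
  exact ⟨hcoe.symm.trans, hcoe.trans⟩

theorem vanishingOn_anti (h : s ⊆ t) : vanishingOn 𝕜 t ≤ vanishingOn 𝕜 s := fun _ hw =>
  mem_vanishingOn_iff.2 (ae_restrict_of_ae_restrict_of_subset h (mem_vanishingOn_iff.1 hw))

theorem mem_vanishingOn_union (hs : w ∈ vanishingOn 𝕜 s) (ht : w ∈ vanishingOn 𝕜 t) :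
    w ∈ vanishingOn 𝕜 (s ∪ t) := by
  rw [mem_vanishingOn_iff] at hs ht ⊢
  exact (ae_restrict_union_iff s t _).2 ⟨hs, ht⟩

theorem shift_mem_vanishingOn (ht : MeasurableSet t) (hw : w ∈ vanishingOn 𝕜 t) {r : ℝ}
    (h : ∀ x ∈ s, r + x ∈ t) : shift 𝕜 r w ∈ vanishingOn 𝕜 s := by
  refine vanishingOn_anti (t := (fun x => r + x) ⁻¹' t) h (mem_vanishingOn_iff.2 ?_)
  filter_upwards [ae_restrict_of_ae (coeFn_shift r w), ((measurePreserving_add_left volume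
    r).restrict_preimage ht).quasiMeasurePreserving.ae (mem_vanishingOn_iff.1 hw)] with x h₁ h₂
  rw [h₁, h₂, Pi.zero_apply, Pi.zero_apply]

theorem exists_mem_vanishingOn_sub_mem (hs : MeasurableSet s) (w : L2R 𝕜) :
    ∃ v ∈ vanishingOn 𝕜 sᶜ, w - v ∈ vanishingOn 𝕜 s := by
  have hmem := (Lp.memLp w).indicator hs
  refine ⟨hmem.toLp _, mem_vanishingOn_iff.2 ?_, mem_vanishingOn_iff.2 ?_⟩
  · filter_upwards [ae_restrict_of_ae hmem.coeFn_toLp, ae_restrict_mem hs.compl] with x h₁ h₂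
    rw [h₁, indicator_of_notMem h₂, Pi.zero_apply]
  · filter_upwards [ae_restrict_of_ae hmem.coeFn_toLp, ae_restrict_mem hs,
      ae_restrict_of_ae (Lp.coeFn_sub w (hmem.toLp _))] with x h₁ h₂ h₃
    rw [h₃, Pi.sub_apply, h₁, indicator_of_mem h₂, sub_self, Pi.zero_apply]

theorem intervalIntegral_mem_vanishingOn {f : ℝ → L2R 𝕜} {a b : ℝ} (hab : a ≤ b)
    (hf : ∀ r ∈ Ioc a b, f r ∈ vanishingOn 𝕜 s) (hfint : IntervalIntegrable f volume a b) :
    ∫ r in a..b, f r ∈ vanishingOn 𝕜 s := by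
  refine LinearMap.mem_ker.2 (((LpToLpRestrictCLM ℝ 𝕜 𝕜 volume 2 s).intervalIntegral_comp_comm
    hfint).symm.trans ?_)
  rw [intervalIntegral.integral_of_le hab]
  exact setIntegral_eq_zero_of_forall_eq_zero fun r hr => LinearMap.mem_ker.1 (hf r hr)

end Vanishing

section Restriction

variable {L : ℝ}

variable (𝕜 L) in
/-- Restriction of functions on `ℝ` to `(0, L)`. -/
def restr : L2R 𝕜 →L[𝕜] L2 𝕜 L := LpToLpRestrictCLM ℝ 𝕜 𝕜 volume 2 (Ioo 0 L)

theorem coeFn_restr (w : L2R 𝕜) : restr 𝕜 L w =ᵐ[μI L] w := LpToLpRestrictCLM_coeFn 𝕜 _ w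

theorem restr_eq_zero {w : L2R 𝕜} (hw : w ∈ vanishingOn 𝕜 (Ioo 0 L)) : restr 𝕜 L w = 0 :=
  LinearMap.mem_ker.1 hw

variable (𝕜 L) in
/-- Extension by zero of functions on `(0, L)`. -/
def ext : L2 𝕜 L →L[𝕜] L2R 𝕜 := (restr 𝕜 L).adjoint

theorem inner_ext_left (y : L2 𝕜 L) (w : L2R 𝕜) :
    ⟪ext 𝕜 L y, w⟫_𝕜 = ⟪y, restr 𝕜 L w⟫_𝕜 :=
  ContinuousLinearMap.adjoint_inner_left _ _ _

theorem coeFn_ext (y : L2 𝕜 L) : ext 𝕜 L y =ᵐ[volume] (Ioo 0 L).indicator y := by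
  have hmem := (memLp_indicator_iff_restrict measurableSet_Ioo).2 (Lp.memLp y)
  suffices h : ext 𝕜 L y = hmem.toLp _ by rw [h]; exact hmem.coeFn_toLp
  refine ext_inner_right 𝕜 fun w => ?_
  rw [inner_ext_left, L2.inner_def, L2.inner_def, ← integral_indicator measurableSet_Ioo]
  refine integral_congr_ae ?_
  filter_upwards [hmem.coeFn_toLp, ae_imp_of_ae_restrict (coeFn_restr (L := L) w)] with x h₁ h₂
  rw [h₁]
  by_cases h : x ∈ Ioo 0 L
  · rw [indicator_of_mem h, indicator_of_mem h, h₂ h]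
  · rw [indicator_of_notMem h, indicator_of_notMem h, inner_zero_left]

theorem ext_mem_vanishingOn (y : L2 𝕜 L) : ext 𝕜 L y ∈ vanishingOn 𝕜 (Ioo 0 L)ᶜ := by
  refine mem_vanishingOn_iff.2 ?_
  filter_upwards [ae_restrict_of_ae (coeFn_ext y), ae_restrict_mem measurableSet_Ioo.compl]
    with x h₁ h₂
  rw [h₁, indicator_of_notMem h₂, Pi.zero_apply]

theorem ext_mem_vanishingOn_Ici {c : ℝ} (hc : L ≤ c) (y : L2 𝕜 L) :
    ext 𝕜 L y ∈ vanishingOn 𝕜 (Ici c) :=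
  vanishingOn_anti (t := (Ioo 0 L)ᶜ) (fun _ hx h => (hc.trans hx).not_gt h.2)
    (ext_mem_vanishingOn y)

theorem restr_ext (y : L2 𝕜 L) : restr 𝕜 L (ext 𝕜 L y) = y := by
  refine Lp.ext ?_
  filter_upwards [coeFn_restr (ext 𝕜 L y), ae_restrict_of_ae (coeFn_ext y),
    ae_restrict_mem measurableSet_Ioo] with x h₁ h₂ h₃
  rw [h₁, h₂, indicator_of_mem h₃]

theorem sub_ext_restr_mem (w : L2R 𝕜) :
    w - ext 𝕜 L (restr 𝕜 L w) ∈ vanishingOn 𝕜 (Ioo 0 L) :=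
  LinearMap.mem_ker.2 ((map_sub (restr 𝕜 L) _ _).trans (by rw [restr_ext, sub_self]))

end Restriction

end

end IntegralTransport

namespace IntegralTransport

noncomputable section

variable {𝕜 : Type*} [RCLike 𝕜] {L : ℝ} (K : L2 𝕜 L →L[𝕜] L2 𝕜 L)

/-- The flow of `w_t = w_x + K w` on the whole line, where `K` acts on `(0, L)` only. Restricted to
`(0, L)` it solves the transport equation with control `u(t) = w(L + t)`. -/
def lineFlow : C0Semigroup 𝕜 (L2R 𝕜) := (shift 𝕜).perturb (ext 𝕜 L ∘L K ∘L restr 𝕜 L)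

theorem lineFlow_sub_shift_mem {t : ℝ} (ht : 0 ≤ t) (w : L2R 𝕜) :
    lineFlow K t w - shift 𝕜 t w ∈ vanishingOn 𝕜 (Ici L) := by
  rw [lineFlow, (shift 𝕜).perturb_eq _ ht, add_sub_cancel_left]
  refine intervalIntegral_mem_vanishingOn ht (fun s hs => ?_) (((shift 𝕜).continuous_duhamel _
    (((shift 𝕜).perturb _).continuous_orbit w) t).intervalIntegrable _ _)
  exact shift_mem_vanishingOn measurableSet_Ioo.compl (ext_mem_vanishingOn _) fun x hx h => by
    linarith [h.2, mem_Ici.1 hx, hs.2]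

theorem lineFlow_mem_vanishingOn {t : ℝ} (ht : 0 ≤ t) {w : L2R 𝕜}
    (hw : w ∈ vanishingOn 𝕜 (Ici (L + t))) : lineFlow K t w ∈ vanishingOn 𝕜 (Ici L) := by
  have hshift : shift 𝕜 t w ∈ vanishingOn 𝕜 (Ici L) :=
    shift_mem_vanishingOn measurableSet_Ici hw fun x hx => by
      rw [mem_Ici] at hx ⊢; linarith
  have := add_mem (lineFlow_sub_shift_mem K ht w) hshift
  rwa [sub_add_cancel] at this

theorem lineFlow_eq_shift {t : ℝ} (ht : 0 ≤ t) {w : L2R 𝕜}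
    (hw : w ∈ vanishingOn 𝕜 (Ioo 0 (L + t))) : lineFlow K t w = shift 𝕜 t w := by
  refine ((shift 𝕜).eq_perturb (ext 𝕜 L ∘L K ∘L restr 𝕜 L) ((shift 𝕜).continuous_orbit w)
    (fun r hr => ?_) ht).symm
  have hzero : ∀ s ∈ uIcc 0 r,
      shift 𝕜 (r - s) ((ext 𝕜 L ∘L K ∘L restr 𝕜 L) (shift 𝕜 s w)) = 0 := fun s hs => by
    rw [uIcc_of_le hr.1] at hs
    have hrestr : restr 𝕜 L (shift 𝕜 s w) = 0 :=
      restr_eq_zero (shift_mem_vanishingOn measurableSet_Ioo hw fun x hx =>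
        ⟨by linarith [hs.1, hx.1], by linarith [hs.2, hr.2, hx.2]⟩)
    simp only [ContinuousLinearMap.comp_apply, hrestr, map_zero]
  rw [intervalIntegral.integral_congr hzero, intervalIntegral.integral_zero, add_zero]

/-- The state at time `t` of the transport equation with initial state `w` on `(0, L)` and control
`s ↦ w(L + s)`. -/
def state (t : ℝ) : L2R 𝕜 →L[𝕜] L2 𝕜 L := restr 𝕜 L ∘L lineFlow K t

theorem state_apply (t : ℝ) (w : L2R 𝕜) : state K t w = restr 𝕜 L (lineFlow K t w) := rfl

theorem state_zero (w : L2R 𝕜) : state K 0 w = restr 𝕜 L w := by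
  rw [state_apply, C0Semigroup.zero_apply]

theorem continuous_state (w : L2R 𝕜) : Continuous fun t => state K t w :=
  (restr 𝕜 L).continuous.comp ((lineFlow K).continuous_orbit w)

theorem state_eq_zero {t : ℝ} (ht : 0 ≤ t) {w : L2R 𝕜}
    (hw : w ∈ vanishingOn 𝕜 (Ioo 0 (L + t))) : state K t w = 0 := by
  rw [state_apply, lineFlow_eq_shift K ht hw]
  exact restr_eq_zero (shift_mem_vanishingOn measurableSet_Ioo hw fun x hx =>
    ⟨by linarith [hx.1], by linarith [hx.2]⟩)

theorem state_eq_of_sub_mem {t : ℝ} (ht : 0 ≤ t) {v w : L2R 𝕜}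
    (h : v - w ∈ vanishingOn 𝕜 (Ioo 0 (L + t))) : state K t v = state K t w := by
  rw [← sub_eq_zero, ← map_sub, state_eq_zero K ht h]

theorem state_ext_restr {t : ℝ} (ht : 0 ≤ t) {w : L2R 𝕜} (hw : w ∈ vanishingOn 𝕜 (Ici L)) :
    state K t (ext 𝕜 L (restr 𝕜 L w)) = state K t w := by
  refine (state_eq_of_sub_mem K ht (vanishingOn_anti (t := Ioo 0 L ∪ Ici L) ?_
    (mem_vanishingOn_union (sub_ext_restr_mem w) (sub_mem hw ?_)))).symm
  · exact fun x hx => (lt_or_ge x L).imp (fun h => ⟨hx.1, h⟩) id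
  · exact ext_mem_vanishingOn_Ici le_rfl _

theorem state_add {s t : ℝ} (hs : 0 ≤ s) (ht : 0 ≤ t) {w : L2R 𝕜}
    (hw : w ∈ vanishingOn 𝕜 (Ici (L + t))) :
    state K (s + t) w = state K s (ext 𝕜 L (state K t w)) := by
  rw [state_apply K t, state_ext_restr K hs (lineFlow_mem_vanishingOn K ht hw), state_apply,
    state_apply, (lineFlow K).add_apply hs ht]

/-- The semigroup of the transport equation without control. -/
def transportSemigroup : C0Semigroup 𝕜 (L2 𝕜 L) where
  toFun t := state K t ∘L ext 𝕜 L
  map_zero' y := (state_zero K _).trans (restr_ext y)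
  map_add' _ _ hs ht y := state_add K hs ht
    (ext_mem_vanishingOn_Ici (le_add_of_nonneg_right ht) y)
  continuous_orbit' y := continuous_state K (ext 𝕜 L y)

theorem transportSemigroup_apply (t : ℝ) (y : L2 𝕜 L) :
    transportSemigroup K t y = state K t (ext 𝕜 L y) := rfl

theorem hasGeneratorAt_transportSemigroup {v g : L2R 𝕜} (hg : (shift 𝕜).HasGeneratorAt v g)
    (hv : v ∈ vanishingOn 𝕜 (Ici L)) : (transportSemigroup K).HasGeneratorAt (restr 𝕜 L v)
      (restr 𝕜 L g + K (restr 𝕜 L v)) := by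
  have h := ((restr 𝕜 L).restrictScalars ℝ).hasFDerivAt.comp_hasDerivWithinAt 0
    (((shift 𝕜).hasGeneratorAt_perturb_iff (ext 𝕜 L ∘L K ∘L restr 𝕜 L)).2 hg)
  simp only [ContinuousLinearMap.coe_restrictScalars', map_add, ContinuousLinearMap.comp_apply,
    restr_ext] at h
  exact h.congr (fun t ht => state_ext_restr K ht hv) (state_ext_restr K le_rfl hv)

/-- The states which can be reached from `0` in time `t`. -/
def reachable (t : ℝ) : Submodule 𝕜 (L2 𝕜 L) :=
  (vanishingOn 𝕜 (Iio L)).map (state K t).toLinearMap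

variable {K}

theorem mem_reachable {t : ℝ} {y : L2 𝕜 L} :
    y ∈ reachable K t ↔ ∃ w ∈ vanishingOn 𝕜 (Iio L), state K t w = y := Iff.rfl

/-- Delaying the control by `s` turns it into a control on a longer time interval. -/
theorem reachable_mono : MonotoneOn (reachable K) (Ici 0) := by
  rintro t ht r - htr _ ⟨w, hw, rfl⟩
  set s := r - t
  have hs : 0 ≤ s := sub_nonneg.2 htr
  refine mem_reachable.2 ⟨shift 𝕜 (-s) w, shift_mem_vanishingOn measurableSet_Iio hw
    fun x hx => ?_, ?_⟩
  · rw [mem_Iio] at hx ⊢; linarith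
  have hdelay : lineFlow K s (shift 𝕜 (-s) w) = w := by
    rw [lineFlow_eq_shift K hs, shift_shift, add_neg_cancel, shift_zero]
    exact shift_mem_vanishingOn measurableSet_Iio hw fun x hx => by
      rw [mem_Iio]; linarith [hx.2]
  rw [← add_sub_cancel t r, state_apply, (lineFlow K).add_apply ht hs, hdelay]
  rfl

theorem transportSemigroup_apply_mem_reachable {s t : ℝ} (hs : 0 ≤ s) (ht : 0 ≤ t) {y : L2 𝕜 L}
    (hy : y ∈ reachable K t) : transportSemigroup K s y ∈ reachable K (s + t) := by
  obtain ⟨w, hw, rfl⟩ := mem_reachable.1 hy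
  obtain ⟨v, hv, hwv⟩ := exists_mem_vanishingOn_sub_mem (measurableSet_Iio (a := L + t)) w
  rw [compl_Iio] at hv
  refine mem_reachable.2 ⟨v, ?_, ?_⟩
  · have := sub_mem hw (vanishingOn_anti (fun x hx => ?_) hwv)
    · rwa [sub_sub_cancel] at this
    · rw [mem_Iio] at hx ⊢; linarith
  · rw [state_add K hs ht hv, transportSemigroup_apply,
      state_eq_of_sub_mem K ht (vanishingOn_anti Ioo_subset_Iio_self hwv)]

/-- For `t ≥ L` the initial data shifted by `t` are admissible controls, and without `K` they are
transported to themselves. -/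
theorem isClosed_reachable_and_finiteDimensional_orthogonal (hK : IsCompactOperator K) {t : ℝ}
    (ht : 0 ≤ t) (hLt : L ≤ t) :
    IsClosed (reachable K t : Set (L2 𝕜 L)) ∧ FiniteDimensional 𝕜 (reachable K t)ᗮ := by
  set C := restr 𝕜 L ∘L (lineFlow K t - shift 𝕜 t) ∘L shift 𝕜 (-t) ∘L ext 𝕜 L with hC_def
  have hC : IsCompactOperator C :=
    (((shift 𝕜).isCompactOperator_perturb_sub ((hK.comp_clm (restr 𝕜 L)).clm_comp (ext 𝕜 L))
      ht).comp_clm (shift 𝕜 (-t) ∘L ext 𝕜 L)).clm_comp (restr 𝕜 L)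
  refine isClosed_and_finiteDimensional_orthogonal_of_range_le
    (isFredholm_one_add_of_isCompactOperator hC) ?_
  rintro _ ⟨y, rfl⟩
  refine mem_reachable.2 ⟨shift 𝕜 (-t) (ext 𝕜 L y), shift_mem_vanishingOn
    measurableSet_Ioo.compl (ext_mem_vanishingOn y) fun x hx h => ?_, ?_⟩
  · linarith [h.1, mem_Iio.1 hx]
  · change _ = y + C y
    simp only [hC_def, ContinuousLinearMap.comp_apply, sub_apply, shift_shift, add_neg_cancel,
      shift_zero, map_sub, restr_ext, state_apply]
    abel

end

end IntegralTransport

theorem inner_intervalIntegral_right {𝕜 H : Type*} [RCLike 𝕜] [NormedAddCommGroup H]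
    [InnerProductSpace 𝕜 H] [NormedSpace ℝ H] [CompleteSpace H] (x : H) {f : ℝ → H} {a b : ℝ}
    (hf : IntervalIntegrable f volume a b) :
    ⟪x, ∫ s in a..b, f s⟫_𝕜 = ∫ s in a..b, ⟪x, f s⟫_𝕜 :=
  ((innerSL 𝕜 x).intervalIntegral_comp_comm hf).symm

theorem inner_intervalIntegral_left {𝕜 H : Type*} [RCLike 𝕜] [NormedAddCommGroup H]
    [InnerProductSpace 𝕜 H] [NormedSpace ℝ H] [CompleteSpace H] (x : H) {f : ℝ → H} {a b : ℝ}
    (hf : IntervalIntegrable f volume a b) :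
    ⟪∫ s in a..b, f s, x⟫_𝕜 = ∫ s in a..b, ⟪f s, x⟫_𝕜 := by
  rw [← inner_conj_symm, inner_intervalIntegral_right x hf,
    ← intervalIntegral.intervalIntegral_conj]
  simp only [inner_conj_symm]

theorem ae_eq_of_forall_intervalIntegral_eq {E : Type*} [NormedAddCommGroup E] [NormedSpace ℝ E]
    [CompleteSpace E] {f g : ℝ → E} (hf : LocallyIntegrable f) (hg : LocallyIntegrable g)
    (h : ∀ a b, ∫ x in a..b, f x = ∫ x in a..b, g x) : f =ᵐ[volume] g := by
  filter_upwards [_root_.LocallyIntegrable.ae_hasDerivAt_integral hf,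
    _root_.LocallyIntegrable.ae_hasDerivAt_integral hg] with x hfx hgx
  simp only [h] at hfx
  exact (hfx 0).unique (hgx 0)

namespace IntegralTransport

noncomputable section

variable {𝕜 : Type*} [RCLike 𝕜] {L : ℝ}

section IntervalIntegral

variable (𝕜) in
/-- Integration over an interval, as a continuous linear functional on `L²(ℝ)`. -/
def intervalIntegralCLM (a b : ℝ) : L2R 𝕜 →L[𝕜] 𝕜 :=
  innerSL 𝕜 (indicatorConstLp 2 (measurableSet_Ioc (a := a) (b := b)) measure_Ioc_lt_top.ne 1) -
    innerSL 𝕜 (indicatorConstLp 2 (measurableSet_Ioc (a := b) (b := a)) measure_Ioc_lt_top.ne 1)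

theorem intervalIntegralCLM_apply (a b : ℝ) (w : L2R 𝕜) :
    intervalIntegralCLM 𝕜 a b w = ∫ x in a..b, w x := by
  rw [intervalIntegralCLM, sub_apply, innerSL_apply_apply, innerSL_apply_apply,
    L2.inner_indicatorConstLp_one, L2.inner_indicatorConstLp_one, intervalIntegral]

theorem intervalIntegral_shift (a b t : ℝ) (w : L2R 𝕜) :
    ∫ x in a..b, shift 𝕜 t w x = ∫ x in t + a..t + b, w x := by
  rw [← intervalIntegral.integral_comp_add_left w t]
  exact intervalIntegral.integral_congr_ae ((coeFn_shift t w).mono fun _ h _ => h)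

theorem intervalIntegral_eq_zero_of_mem_vanishingOn {w : L2R 𝕜} {s : Set ℝ} {a b : ℝ}
    (hw : w ∈ vanishingOn 𝕜 s) (hab : a ≤ b) (h : Ioo a b ⊆ s) : ∫ x in a..b, w x = 0 := by
  rw [intervalIntegral.integral_of_le hab, integral_Ioc_eq_integral_Ioo]
  exact integral_eq_zero_of_ae (mem_vanishingOn_iff.1 (vanishingOn_anti h hw))

/-- Both sides have the same integrals over intervals. -/
theorem coeFn_integral_shift (a b : ℝ) (w : L2R 𝕜) :
    (∫ s in a..b, shift 𝕜 s w : L2R 𝕜) =ᵐ[volume] fun x => ∫ r in a + x..b + x, w r := by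
  set P : ℝ → 𝕜 := fun x => ∫ r in (0 : ℝ)..x, w r
  have hP : Continuous P := intervalIntegral.continuous_primitive (intervalIntegrable_coe w) 0
  have hsub (c d : ℝ) : ∫ r in c..d, w r = P d - P c :=
    (intervalIntegral.integral_interval_sub_left (intervalIntegrable_coe w _ _)
      (intervalIntegrable_coe w _ _)).symm
  have hadd (c : ℝ) : Continuous fun x => P (c + x) := hP.comp (continuous_const.add continuous_id)
  simp only [hsub]
  refine ae_eq_of_forall_intervalIntegral_eq (locallyIntegrable_coe _)
    ((hadd b).sub (hadd a)).locallyIntegrable fun c d => ?_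
  have hadd' (c : ℝ) : Continuous fun x => P (x + c) := hP.comp (continuous_id.add continuous_const)
  rw [← intervalIntegralCLM_apply, ← (intervalIntegralCLM 𝕜 c d).intervalIntegral_comp_comm
    (((shift 𝕜).continuous_orbit w).intervalIntegrable _ _)]
  simp only [intervalIntegralCLM_apply, intervalIntegral_shift, hsub]
  have hi (f : ℝ → 𝕜) (hf : Continuous f) (a b : ℝ) := hf.intervalIntegrable (μ := volume) a b
  rw [intervalIntegral.integral_sub (hi _ (hadd' d) _ _) (hi _ (hadd' c) _ _),
    intervalIntegral.integral_sub (hi _ (hadd b) _ _) (hi _ (hadd a) _ _),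
    intervalIntegral.integral_comp_add_right, intervalIntegral.integral_comp_add_right,
    intervalIntegral.integral_comp_add_left, intervalIntegral.integral_comp_add_left,
    intervalIntegral.integral_interval_sub_interval_comm' (hi P hP _ _) (hi P hP _ _) (hi P hP _ _)]

end IntervalIntegral

section Primitive

variable (𝕜 L) in
/-- The operator `(prim g)(x) = ∫ₓᴸ g`. -/
def prim : L2 𝕜 L →L[𝕜] L2 𝕜 L := restr 𝕜 L ∘L (shift 𝕜).integralCLM L ∘L ext 𝕜 L

theorem prim_apply (g : L2 𝕜 L) :
    prim 𝕜 L g = restr 𝕜 L (∫ s in (0 : ℝ)..L, shift 𝕜 s (ext 𝕜 L g)) := rfl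

theorem adjoint_prim_apply (g : L2 𝕜 L) :
    (prim 𝕜 L).adjoint g = restr 𝕜 L (∫ s in -L..0, shift 𝕜 s (ext 𝕜 L g)) := by
  have hint (v : L2R 𝕜) (a b : ℝ) :=
    ((shift 𝕜).continuous_orbit v).intervalIntegrable (μ := volume) a b
  refine ext_inner_right 𝕜 fun f => ?_
  rw [ContinuousLinearMap.adjoint_inner_left, prim_apply, ← inner_ext_left,
    inner_intervalIntegral_right _ (hint _ _ _), ← inner_conj_symm (restr 𝕜 L _), ← inner_ext_left,
    inner_conj_symm, inner_intervalIntegral_left _ (hint _ _ _)]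
  simp only [inner_shift_left]
  rw [intervalIntegral.integral_comp_neg fun s => ⟪ext 𝕜 L g, shift 𝕜 s (ext 𝕜 L f)⟫_𝕜, neg_zero,
    neg_neg]

theorem coeFn_prim (g : L2 𝕜 L) :
    prim 𝕜 L g =ᵐ[μI L] fun x => ∫ r in x..L, ext 𝕜 L g r := by
  filter_upwards [coeFn_restr (∫ s in (0 : ℝ)..L, shift 𝕜 s (ext 𝕜 L g)),
    ae_restrict_of_ae (coeFn_integral_shift 0 L (ext 𝕜 L g)), ae_restrict_mem measurableSet_Ioo]
    with x h₁ h₂ hx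
  have hzero : ∫ r in L..L + x, ext 𝕜 L g r = 0 :=
    intervalIntegral_eq_zero_of_mem_vanishingOn (ext_mem_vanishingOn_Ici le_rfl g)
      (by linarith [hx.1]) fun r hr => hr.1.le
  rw [prim_apply, h₁, h₂, zero_add, ← intervalIntegral.integral_add_adjacent_intervals
    (intervalIntegrable_coe _ x L) (intervalIntegrable_coe _ L (L + x)), hzero, add_zero]

theorem coeFn_adjoint_prim (g : L2 𝕜 L) :
    (prim 𝕜 L).adjoint g =ᵐ[μI L] fun x => ∫ r in (0 : ℝ)..x, ext 𝕜 L g r := by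
  filter_upwards [coeFn_restr (∫ s in -L..0, shift 𝕜 s (ext 𝕜 L g)),
    ae_restrict_of_ae (coeFn_integral_shift (-L) 0 (ext 𝕜 L g)), ae_restrict_mem measurableSet_Ioo]
    with x h₁ h₂ hx
  have hzero : ∫ r in -L + x..0, ext 𝕜 L g r = 0 :=
    intervalIntegral_eq_zero_of_mem_vanishingOn (ext_mem_vanishingOn g)
      (by linarith [hx.2]) fun r hr h => lt_asymm hr.2 h.1
  rw [adjoint_prim_apply, h₁, h₂, zero_add, ← intervalIntegral.integral_add_adjacent_intervals
    (intervalIntegrable_coe _ (-L + x) 0) (intervalIntegrable_coe _ 0 x), hzero, zero_add]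

theorem intervalIntegral_ext_restr {a b : ℝ} (ha : 0 ≤ a) (hab : a ≤ b) (hb : b ≤ L) (w : L2R 𝕜) :
    ∫ x in a..b, ext 𝕜 L (restr 𝕜 L w) x = ∫ x in a..b, w x := by
  rw [← intervalIntegralCLM_apply, ← intervalIntegralCLM_apply, eq_comm, ← sub_eq_zero, ← map_sub,
    intervalIntegralCLM_apply]
  exact intervalIntegral_eq_zero_of_mem_vanishingOn (sub_ext_restr_mem w) hab
    fun x hx => ⟨ha.trans_lt hx.1, hx.2.trans_le hb⟩

variable (𝕜 L) in
/-- The constant function `1` in `L²(0, L)`. -/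
def one : L2 𝕜 L := Lp.const 2 (μI L) 1

theorem coeFn_one : one 𝕜 L =ᵐ[μI L] fun _ => 1 := Lp.coeFn_const _ _ _

theorem inner_one_left (hL : 0 ≤ L) (g : L2 𝕜 L) :
    ⟪one 𝕜 L, g⟫_𝕜 = ∫ x in (0 : ℝ)..L, ext 𝕜 L g x := by
  rw [one, ← indicatorConstLp_univ, L2.inner_indicatorConstLp_one, setIntegral_univ,
    intervalIntegral.integral_of_le hL, integral_Ioc_eq_integral_Ioo]
  nth_rw 1 [← restr_ext g]
  exact integral_congr_ae (coeFn_restr _)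

theorem hasTrace_prim (g : L2 𝕜 L) : HasTrace (prim 𝕜 L g) L 0 := by
  refine ⟨_, ?_, coeFn_prim g, intervalIntegral.integral_same⟩
  simp only [intervalIntegral.integral_symm L]
  exact (intervalIntegral.continuous_primitive (intervalIntegrable_coe _) L).neg.continuousOn

theorem hasTrace_adjoint_prim (hL : 0 ≤ L) (g : L2 𝕜 L) :
    HasTrace ((prim 𝕜 L).adjoint g) L ⟪one 𝕜 L, g⟫_𝕜 :=
  ⟨_, (intervalIntegral.continuous_primitive (intervalIntegrable_coe _) 0).continuousOn,
    coeFn_adjoint_prim g, (inner_one_left hL g).symm⟩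

/-- The solution `w(s + x)` of `w_t = w_x`, integrated over `(0, t) × (x, L)`. -/
theorem prim_restr_shift_sub (t : ℝ) (w : L2R 𝕜) :
    prim 𝕜 L (restr 𝕜 L (shift 𝕜 t w)) - prim 𝕜 L (restr 𝕜 L w)
      = (∫ x in L..L + t, w x) • one 𝕜 L - restr 𝕜 L (∫ s in (0 : ℝ)..t, shift 𝕜 s w) := by
  have hprim (v : L2R 𝕜) : prim 𝕜 L (restr 𝕜 L v) =ᵐ[μI L] fun x => ∫ r in x..L, v r := by
    filter_upwards [coeFn_prim (restr 𝕜 L v), ae_restrict_mem measurableSet_Ioo] with x hx hm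
    rw [hx, intervalIntegral_ext_restr hm.1.le hm.2.le le_rfl]
  refine Lp.ext ?_
  filter_upwards [hprim (shift 𝕜 t w), hprim w, Lp.coeFn_sub (prim 𝕜 L (restr 𝕜 L (shift 𝕜 t w)))
      (prim 𝕜 L (restr 𝕜 L w)), Lp.coeFn_sub ((∫ x in L..L + t, w x) • one 𝕜 L)
      (restr 𝕜 L (∫ s in (0 : ℝ)..t, shift 𝕜 s w)), Lp.coeFn_smul (∫ x in L..L + t, w x) (one 𝕜 L),
    coeFn_one (𝕜 := 𝕜) (L := L), coeFn_restr (L := L) (∫ s in (0 : ℝ)..t, shift 𝕜 s w),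
    ae_restrict_of_ae (coeFn_integral_shift 0 t w)] with x h₁ h₂ h₃ h₄ h₅ h₆ h₇ h₈
  rw [h₃, h₄, Pi.sub_apply, Pi.sub_apply, h₁, h₂, h₅, Pi.smul_apply, h₆, h₇, h₈, smul_eq_mul,
    mul_one, zero_add, intervalIntegral_shift, add_comm L t]
  exact intervalIntegral.integral_interval_sub_interval_comm' (intervalIntegrable_coe w _ _)
    (intervalIntegrable_coe w _ _) (intervalIntegrable_coe w _ _)

end Primitive

end

end IntegralTransport

/-- The antiderivative is constant to the left and to the right of the supports. -/
theorem exists_contDiff_deriv_eq_of_integral_eq_zero {η : ℝ → ℝ} {a b : ℝ} (hη : ContDiff ℝ ∞ η)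
    (hc : HasCompactSupport η) (hs : tsupport η ⊆ Ioo a b) (hint : ∫ x, η x = 0) :
    ∃ Φ : ℝ → ℝ, ContDiff ℝ ∞ Φ ∧ HasCompactSupport Φ ∧ tsupport Φ ⊆ Ioo a b ∧ deriv Φ = η := by
  rcases (tsupport η).eq_empty_or_nonempty with hempty | hne
  · refine ⟨0, contDiff_const, HasCompactSupport.zero, by simp [tsupport], ?_⟩
    rw [tsupport_eq_empty_iff.1 hempty, deriv_zero]
  obtain ⟨α, hαmem, hα⟩ := hc.isCompact.exists_isLeast hne
  obtain ⟨β, hβmem, hβ⟩ := hc.isCompact.exists_isGreatest hne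
  set Φ : ℝ → ℝ := fun x => ∫ r in a..x, η r
  have hderiv (x : ℝ) : HasDerivAt Φ (η x) x := hη.continuous.integral_hasStrictDerivAt a x
    |>.hasDerivAt
  have hderiv_eq : deriv Φ = η := funext fun x => (hderiv x).deriv
  have hsupp : Function.support η ⊆ Icc α β := fun x hx =>
    ⟨hα (subset_tsupport η hx), hβ (subset_tsupport η hx)⟩
  have hΦ : Function.support Φ ⊆ Icc α β := fun x hx => by
    by_contra h
    refine hx ?_
    rcases lt_or_ge x α with hxα | hαx
    · refine (intervalIntegral.integral_congr fun r hr => ?_).trans intervalIntegral.integral_zero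
      by_contra hr0
      exact ((hsupp hr0).1.trans hr.2).not_gt (max_lt (hs hαmem).1 hxα)
    · have hβx : β < x := lt_of_not_ge fun hxβ => h ⟨hαx, hxβ⟩
      rw [← hint]
      exact intervalIntegral.integral_eq_integral_of_support_subset fun r hr =>
        ⟨(hs hαmem).1.trans_le (hsupp hr).1, (hsupp hr).2.trans hβx.le⟩
  have hΦt : tsupport Φ ⊆ Icc α β := closure_minimal hΦ isClosed_Icc
  exact ⟨Φ, contDiff_infty_iff_deriv.2 ⟨fun x => (hderiv x).differentiableAt, hderiv_eq ▸ hη⟩,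
    HasCompactSupport.of_support_subset_isCompact isCompact_Icc hΦ,
    hΦt.trans (Icc_subset_Ioo (hs hαmem).1 (hs hβmem).2), hderiv_eq⟩

namespace IntegralTransport

variable {𝕜 : Type*} [RCLike 𝕜] {L : ℝ}

section DuBoisReymond

/-- The difference of two test functions of integral `1` is the derivative of a test function. -/
theorem HasWeakDeriv.integral_smul_eq {d : L2 𝕜 L} (hd : HasWeakDeriv d 0) {φ ψ : ℝ → ℝ}
    (hφ : ContDiff ℝ ∞ φ) (hφc : HasCompactSupport φ) (hφs : tsupport φ ⊆ Ioo 0 L)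
    (hψ : ContDiff ℝ ∞ ψ) (hψc : HasCompactSupport ψ) (hψs : tsupport ψ ⊆ Ioo 0 L)
    (hψint : ∫ x, ψ x = 1) :
    ∫ x in Ioo 0 L, φ x • d x = (∫ x, φ x) • ∫ x in Ioo 0 L, ψ x • d x := by
  set m := ∫ x, φ x
  have hint : ∫ x, (φ x - m * ψ x) = 0 := by
    rw [integral_sub (hφ.continuous.integrable_of_hasCompactSupport hφc)
      ((hψ.continuous.integrable_of_hasCompactSupport hψc).const_mul m),
      integral_const_mul, hψint, mul_one, sub_self]
  obtain ⟨Φ, hΦ, hΦc, hΦs, hderiv⟩ := exists_contDiff_deriv_eq_of_integral_eq_zero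
    (hφ.sub (contDiff_const.mul hψ)) (hφc.sub hψc.mul_left)
    ((tsupport_sub _ _).trans (union_subset hφs ((tsupport_mul_subset_right).trans hψs))) hint
  have hzero : ∫ x in Ioo 0 L, deriv Φ x • d x = 0 := by
    rw [hd Φ hΦ hΦc hΦs, neg_eq_zero]
    refine integral_eq_zero_of_ae ((Lp.coeFn_zero 𝕜 2 (μI L)).mono fun x hx => ?_)
    change Φ x • (0 : L2 𝕜 L) x = 0
    rw [hx, Pi.zero_apply, smul_zero]
  rw [hderiv] at hzero
  simp only [sub_smul, mul_smul] at hzero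
  have hmψ : Integrable (fun x => m • ψ x • d x) (μI L) :=
    (integrable_smul_coe d hψ.continuous hψc).smul m
  rwa [integral_sub (integrable_smul_coe d hφ.continuous hφc) hmψ, integral_smul,
    sub_eq_zero] at hzero

theorem HasWeakDeriv.exists_ae_eq_const {d : L2 𝕜 L} (hL : 0 < L) (hd : HasWeakDeriv d 0) :
    ∃ c : 𝕜, d =ᵐ[μI L] fun _ => c := by
  let b : ContDiffBump (L / 2) := ⟨L / 8, L / 4, by positivity, by linarith⟩
  have hbs : tsupport (b.normed volume) ⊆ Ioo 0 L := by
    rw [b.tsupport_normed_eq, Real.closedBall_eq_Icc]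
    change Icc (L / 2 - L / 4) (L / 2 + L / 4) ⊆ Ioo 0 L
    exact Icc_subset_Ioo (by linarith) (by linarith)
  set c := ∫ x in Ioo 0 L, b.normed volume x • d x
  have hae := isOpen_Ioo.ae_eq_zero_of_integral_contDiff_smul_eq_zero (U := Ioo 0 L)
    (μ := μI L) (f := fun x => d x - c)
    (((integrable_coe d).sub (integrable_const c)).locallyIntegrable.locallyIntegrableOn _)
    fun φ hφ hφc hφs => by
      have hφint : ∫ x in Ioo 0 L, φ x = ∫ x, φ x :=
        setIntegral_eq_integral_of_forall_compl_eq_zero fun x hx =>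
          image_eq_zero_of_notMem_tsupport fun h => hx (hφs h)
      simp only [smul_sub]
      rw [integral_sub (integrable_smul_coe d hφ.continuous hφc)
        ((hφ.continuous.integrable_of_hasCompactSupport hφc).restrict.smul_const c),
        integral_smul_const, hφint, sub_eq_zero]
      exact hd.integral_smul_eq hφ hφc hφs b.contDiff_normed b.hasCompactSupport_normed hbs
        b.integral_normed
  refine ⟨c, ?_⟩
  filter_upwards [hae, ae_restrict_mem measurableSet_Ioo] with x hx hm
  exact sub_eq_zero.1 (hx hm)

theorem eq_zero_of_hasWeakDeriv_zero {d : L2 𝕜 L} (hL : 0 < L) (hd : HasWeakDeriv d 0)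
    (ht : HasTrace d L 0) : d = 0 := by
  obtain ⟨c, hc⟩ := hd.exists_ae_eq_const hL
  have hc0 : c = 0 := HasTrace.unique hL (right_mem_Icc.2 hL.le)
    ⟨fun _ => c, continuousOn_const, hc, rfl⟩ ht
  exact Lp.ext (hc.trans (hc0 ▸ (Lp.coeFn_zero 𝕜 2 (μI L)).symm))

end DuBoisReymond

section GeneratorDomain

theorem hasWeakDeriv_prim (g : L2 𝕜 L) : HasWeakDeriv (prim 𝕜 L g) (-g) := by
  intro φ hφ hφc hφs
  have hmem {ψ : ℝ → ℝ} (hψ : Continuous ψ) (hc : HasCompactSupport ψ) :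
      MemLp (fun x => (ψ x : 𝕜)) 2 :=
    (hψ.memLp_of_hasCompactSupport hc).ofReal
  have hinner {ψ : ℝ → ℝ} (hψ : Continuous ψ) (hc : HasCompactSupport ψ) (f : L2 𝕜 L) :
      ⟪restr 𝕜 L ((hmem hψ hc).toLp _), f⟫_𝕜 = ∫ x in Ioo 0 L, ψ x • f x := by
    rw [L2.inner_def]
    refine integral_congr_ae ?_
    filter_upwards [coeFn_restr (L := L) ((hmem hψ hc).toLp _),
      ae_restrict_of_ae (hmem hψ hc).coeFn_toLp] with x h₁ h₂
    rw [h₁, h₂, RCLike.inner_apply, RCLike.conj_ofReal, RCLike.real_smul_eq_coe_mul, mul_comm]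
  have hφ' : Continuous (deriv φ) := hφ.continuous_deriv (by simp)
  rw [← hinner hφ' hφc.deriv, ← hinner hφ.continuous hφc, inner_neg_right, neg_neg,
    ← ContinuousLinearMap.adjoint_inner_left]
  congr 1
  refine Lp.ext ?_
  filter_upwards [coeFn_adjoint_prim (restr 𝕜 L ((hmem hφ' hφc.deriv).toLp _)),
    coeFn_restr (L := L) ((hmem hφ.continuous hφc).toLp _),
    ae_restrict_of_ae (hmem hφ.continuous hφc).coeFn_toLp, ae_restrict_mem measurableSet_Ioo]
    with x h₁ h₂ h₃ hx
  have h0 : φ 0 = 0 := image_eq_zero_of_notMem_tsupport fun h => (hφs h).1.false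
  rw [h₁, h₂, h₃, intervalIntegral_ext_restr le_rfl hx.1.le hx.2.le,
    intervalIntegral.integral_congr_ae ((hmem hφ' hφc.deriv).coeFn_toLp.mono fun r hr _ => hr),
    RCLike.intervalIntegral_ofReal, intervalIntegral.integral_deriv_eq_sub
      (fun r _ => (hφ.differentiable (by simp)).differentiableAt) (hφ'.intervalIntegrable _ _), h0,
    sub_zero]

theorem neg_prim_mem_generatorDomain (g : L2 𝕜 L) : -prim 𝕜 L g ∈ generatorDomain 𝕜 L :=
  neg_mem ⟨⟨_, hasWeakDeriv_prim g⟩, hasTrace_prim g⟩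

theorem eq_neg_prim_weakDeriv (hL : 0 < L) (y : generatorDomain 𝕜 L) :
    (y : L2 𝕜 L) = -prim 𝕜 L (weakDeriv 𝕜 L y) := by
  refine eq_neg_iff_add_eq_zero.2 (eq_zero_of_hasWeakDeriv_zero hL ?_ ?_)
  · simpa only [add_neg_cancel] using (weakDeriv_spec y).add (hasWeakDeriv_prim (weakDeriv 𝕜 L y))
  · simpa only [add_zero] using y.2.2.add (hasTrace_prim (weakDeriv 𝕜 L y))

theorem weakDeriv_neg_prim (g : L2 𝕜 L) :
    weakDeriv 𝕜 L ⟨-prim 𝕜 L g, neg_prim_mem_generatorDomain g⟩ = g := by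
  refine (weakDeriv_spec _).unique ?_
  simpa only [neg_smul, one_smul, neg_neg] using (hasWeakDeriv_prim g).smul (-1)

end GeneratorDomain

end IntegralTransport

namespace IntegralTransport

variable {𝕜 : Type*} [RCLike 𝕜] {L : ℝ}

section Generator

theorem dense_generatorDomain : Dense (generatorDomain 𝕜 L : Set (L2 𝕜 L)) := by
  intro y
  have h := (restr 𝕜 L).continuous.continuousAt.tendsto.comp
    ((shift 𝕜).tendsto_inv_smul_integral_orbit (ext 𝕜 L y))
  rw [restr_ext] at h
  refine mem_closure_of_tendsto h ?_
  filter_upwards [self_mem_nhdsWithin] with ε hε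
  have hzero : ∫ x in L..L + ε, ext 𝕜 L y x = 0 :=
    intervalIntegral_eq_zero_of_mem_vanishingOn (ext_mem_vanishingOn_Ici le_rfl y)
      (le_add_of_nonneg_right (le_of_lt hε)) fun x hx => hx.1.le
  have hprim := prim_restr_shift_sub (L := L) ε (ext 𝕜 L y)
  rw [hzero, zero_smul, zero_sub, ← map_sub, eq_neg_iff_add_eq_zero, add_comm,
    ← eq_neg_iff_add_eq_zero] at hprim
  rw [Function.comp_apply, ContinuousLinearMap.map_smul_of_tower, hprim]
  exact ((generatorDomain 𝕜 L).restrictScalars ℝ).smul_mem _ (neg_prim_mem_generatorDomain _)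

theorem hasGeneratorAt_transportSemigroup_neg_prim (hL : 0 ≤ L) (K : L2 𝕜 L →L[𝕜] L2 𝕜 L)
    (g : L2 𝕜 L) :
    (transportSemigroup K).HasGeneratorAt (-prim 𝕜 L g) (g + K (-prim 𝕜 L g)) := by
  set v : L2R 𝕜 := ∫ s in (0 : ℝ)..L, shift 𝕜 s (ext 𝕜 L (-g)) with hv_def
  have hv : v ∈ vanishingOn 𝕜 (Ici L) := by
    refine intervalIntegral_mem_vanishingOn hL (fun s hs => ?_)
      (((shift 𝕜).continuous_orbit _).intervalIntegrable _ _)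
    exact shift_mem_vanishingOn measurableSet_Ici (ext_mem_vanishingOn_Ici le_rfl _)
      fun x hx => le_add_of_nonneg_of_le hs.1.le hx
  have hrestr : restr 𝕜 L v = -prim 𝕜 L g := by rw [hv_def, ← prim_apply, map_neg]
  have hshift : restr 𝕜 L (shift 𝕜 L (ext 𝕜 L (-g))) = 0 :=
    restr_eq_zero (shift_mem_vanishingOn measurableSet_Ici (ext_mem_vanishingOn_Ici le_rfl _)
      fun x hx => le_add_of_nonneg_right hx.1.le)
  have h := hasGeneratorAt_transportSemigroup K
    ((shift 𝕜).hasGeneratorAt_integral_orbit (ext 𝕜 L (-g)) hL) hv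
  rwa [hrestr, map_sub, hshift, restr_ext, zero_sub, neg_neg] at h

variable {k : ℝ × ℝ → ℝ} (hk : MemLp k 2 ((μI L).prod (μI L)))

theorem generator_neg_prim (g : L2 𝕜 L) :
    generator 𝕜 k hk ⟨-prim 𝕜 L g, neg_prim_mem_generatorDomain g⟩
      = g + integralOperator 𝕜 k hk (-prim 𝕜 L g) :=
  congrArg (· + integralOperator 𝕜 k hk (-prim 𝕜 L g)) (weakDeriv_neg_prim g)

theorem hasGeneratorAt_generator (hL : 0 < L) (y : (generator 𝕜 k hk).domain) :
    (transportSemigroup (integralOperator 𝕜 k hk)).HasGeneratorAt y (generator 𝕜 k hk y) := by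
  have h := hasGeneratorAt_transportSemigroup_neg_prim hL.le (integralOperator 𝕜 k hk)
    (weakDeriv 𝕜 L y)
  rwa [← eq_neg_prim_weakDeriv hL y] at h

end Generator

section Adjoint

variable {k : ℝ × ℝ → ℝ} {hk : MemLp k 2 ((μI L).prod (μI L))}

theorem eq_neg_adjoint_prim (z : (generator 𝕜 k hk)†.domain) :
    (z : L2 𝕜 L) = -(prim 𝕜 L).adjoint
      ((generator 𝕜 k hk)† z - (integralOperator 𝕜 k hk).adjoint z) := by
  refine ext_inner_right 𝕜 fun g => ?_
  have h := LinearPMap.adjoint_isFormalAdjoint (dense_generatorDomain (𝕜 := 𝕜) (L := L)) z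
    (⟨-prim 𝕜 L g, neg_prim_mem_generatorDomain g⟩ : (generator 𝕜 k hk).domain)
  rw [generator_neg_prim, inner_add_right, ← ContinuousLinearMap.adjoint_inner_left,
    ← sub_eq_iff_eq_add, ← inner_sub_left] at h
  rw [← h, inner_neg_left, ContinuousLinearMap.adjoint_inner_left, inner_neg_right]

theorem controlAdjoint_eq (hL : 0 < L) (z : (generator 𝕜 k hk)†.domain) :
    controlAdjoint 𝕜 k hk z = -⟪one 𝕜 L,
      (generator 𝕜 k hk)† z - (integralOperator 𝕜 k hk).adjoint z⟫_𝕜 := by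
  have h := (hasTrace_adjoint_prim hL.le
    ((generator 𝕜 k hk)† z - (integralOperator 𝕜 k hk).adjoint z)).smul (-1)
  rw [neg_smul, one_smul, neg_one_mul, ← eq_neg_adjoint_prim z] at h
  exact h.trace_eq hL (right_mem_Icc.2 hL.le)

theorem controlAdjoint_smul (hL : 0 < L) (a : 𝕜) (z : (generator 𝕜 k hk)†.domain) :
    controlAdjoint 𝕜 k hk (a • z) = a • controlAdjoint 𝕜 k hk z := by
  rw [controlAdjoint_eq hL, controlAdjoint_eq hL, LinearPMap.map_smul, Submodule.coe_smul, map_smul,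
    ← smul_sub, inner_smul_right, smul_eq_mul, mul_neg]

/-- Green's formula: `c` is the boundary value of `c • one - prim f` at `L`. -/
theorem inner_adjoint_smul_one_sub_prim (hL : 0 < L) (z : (generator 𝕜 k hk)†.domain) (c : 𝕜)
    (f : L2 𝕜 L) :
    ⟪(generator 𝕜 k hk)† z, c • one 𝕜 L - prim 𝕜 L f⟫_𝕜
      = ⟪(z : L2 𝕜 L), f + integralOperator 𝕜 k hk (c • one 𝕜 L - prim 𝕜 L f)⟫_𝕜
        - ⟪controlAdjoint 𝕜 k hk z, c⟫_𝕜 := by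
  have h := congrArg (⟪·, f⟫_𝕜) (eq_neg_adjoint_prim z)
  simp only [inner_neg_left, ContinuousLinearMap.adjoint_inner_left, inner_sub_left] at h
  rw [inner_add_right, controlAdjoint_eq hL, h, inner_neg_left, RCLike.inner_apply,
    inner_conj_symm]
  simp only [inner_sub_left, inner_sub_right, inner_smul_right, map_sub, map_smul,
    ContinuousLinearMap.adjoint_inner_left]
  ring

end Adjoint

end IntegralTransport

theorem memLp_restrict_Ioo_of_continuousOn {E : Type*} [NormedAddCommGroup E] {f : ℝ → E}
    {a b : ℝ} (hf : ContinuousOn f (Icc a b)) (p : ℝ≥0∞) :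
    MemLp f p (volume.restrict (Ioo a b)) := by
  obtain ⟨C, hC⟩ := isCompact_Icc.exists_bound_of_continuousOn hf
  refine MemLp.of_bound ((hf.mono Ioo_subset_Icc_self).aestronglyMeasurable measurableSet_Ioo) C ?_
  filter_upwards [ae_restrict_mem measurableSet_Ioo] with x hx
  exact hC x (Ioo_subset_Icc_self hx)

namespace IntegralTransport

variable {𝕜 : Type*} [RCLike 𝕜] {L : ℝ}

section Boundary

variable (K : L2 𝕜 L →L[𝕜] L2 𝕜 L)

theorem restr_eq_smul_one_sub_prim {w g : L2R 𝕜} {c : 𝕜} (hg : (shift 𝕜).HasGeneratorAt w g)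
    (hc : HasDerivWithinAt (fun ε => ∫ x in L..L + ε, w x) c (Ici 0) 0) :
    restr 𝕜 L w = c • one 𝕜 L - prim 𝕜 L (restr 𝕜 L g) := by
  have hleft := (((prim 𝕜 L ∘L restr 𝕜 L).restrictScalars ℝ).hasFDerivAt.comp_hasDerivWithinAt 0
    hg).sub_const (prim 𝕜 L (restr 𝕜 L w))
  have hcont := (shift 𝕜).continuous_orbit w
  have hright := (hc.smul_const (one 𝕜 L)).sub
    (((restr 𝕜 L).restrictScalars ℝ).hasFDerivAt.comp_hasDerivWithinAt 0
      (intervalIntegral.integral_hasDerivAt_right (a := 0) (b := 0)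
        (hcont.intervalIntegrable _ _) (hcont.stronglyMeasurableAtFilter _ _)
        hcont.continuousAt).hasDerivWithinAt)
  have heq := (uniqueDiffWithinAt_Ici (0 : ℝ)).eq_deriv _ hleft
    (hright.congr (fun t _ => prim_restr_shift_sub t w) (prim_restr_shift_sub 0 w))
  rw [ContinuousLinearMap.coe_restrictScalars', ContinuousLinearMap.coe_restrictScalars',
    shift_zero, ContinuousLinearMap.comp_apply] at heq
  rw [heq, sub_sub_cancel]

/-- Beyond `x = L` the flow is the translation, so its boundary value at `L` is the control. -/
theorem ae_hasDerivWithinAt_integral_lineFlow (w : L2R 𝕜) : ∀ᵐ t, 0 ≤ t →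
    HasDerivWithinAt (fun ε => ∫ x in L..L + ε, lineFlow K t w x) (w (L + t)) (Ici 0) 0 := by
  have hae := (measurePreserving_add_left volume L).quasiMeasurePreserving.ae
    (_root_.LocallyIntegrable.ae_hasDerivAt_integral (locallyIntegrable_coe w))
  filter_upwards [hae] with t hderiv ht
  have hcomp : HasDerivAt (fun ε => ∫ x in L + t..L + t + ε, w x) (w (L + t)) 0 := by
    have h := hderiv (L + t)
    rw [← add_zero (L + t)] at h
    simpa only [add_zero] using h.comp_const_add (L + t) 0
  have hflow {ε : ℝ} (hε : 0 ≤ ε) :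
      ∫ x in L..L + ε, lineFlow K t w x = ∫ x in L + t..L + t + ε, w x := by
    have hzero := intervalIntegral_eq_zero_of_mem_vanishingOn (lineFlow_sub_shift_mem K ht w)
      (le_add_of_nonneg_right hε) fun x hx => hx.1.le
    rw [← intervalIntegralCLM_apply, map_sub, intervalIntegralCLM_apply, intervalIntegralCLM_apply,
      intervalIntegral_shift, sub_eq_zero] at hzero
    rw [hzero, add_left_comm, ← add_assoc, add_comm t L]
  exact hcomp.hasDerivWithinAt.congr (fun ε hε => hflow hε) (hflow le_rfl)

theorem ae_state_eq_smul_one_sub_prim {w g : L2R 𝕜} (hg : (lineFlow K).HasGeneratorAt w g) :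
    ∀ᵐ t, 0 ≤ t → state K t w
      = w (L + t) • one 𝕜 L - prim 𝕜 L (state K t g - K (state K t w)) := by
  filter_upwards [ae_hasDerivWithinAt_integral_lineFlow K w] with t hderiv ht
  have hgen := hg.apply ht
  rw [← sub_add_cancel (lineFlow K t g) ((ext 𝕜 L ∘L K ∘L restr 𝕜 L) (lineFlow K t w))] at hgen
  have hrestr := restr_eq_smul_one_sub_prim (((shift 𝕜).hasGeneratorAt_perturb_iff _).1 hgen)
    (hderiv ht)
  rwa [map_sub, ContinuousLinearMap.comp_apply, restr_ext] at hrestr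

theorem hasDerivWithinAt_state {w g : L2R 𝕜} (hg : (lineFlow K).HasGeneratorAt w g) {t : ℝ}
    (ht : 0 ≤ t) : HasDerivWithinAt (fun s => state K s w) (state K t g) (Ici 0) t :=
  ((restr 𝕜 L).restrictScalars ℝ).hasFDerivAt.comp_hasDerivWithinAt t
    (hg.hasDerivWithinAt_Ici_zero ht)

end Boundary

section Transposition

variable {k : ℝ × ℝ → ℝ} {hk : MemLp k 2 ((μI L).prod (μI L))}
  {τ : ℝ} {ζ : ℝ → (generator 𝕜 k hk)†.domain}

theorem continuousOn_controlAdjoint (hL : 0 < L)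
    (hζ : IsAdjointSolution (generator 𝕜 k hk) τ ζ) :
    ContinuousOn (fun t => controlAdjoint 𝕜 k hk (ζ t)) (Icc 0 τ) := by
  have hcont : ContinuousOn (fun t => (ζ t : L2 𝕜 L)) (Icc 0 τ) :=
    fun t ht => (hζ.1 t ht).continuousWithinAt
  simp only [controlAdjoint_eq hL]
  exact (((innerSL 𝕜 (one 𝕜 L)).continuous.comp_continuousOn
    (hζ.2.sub ((integralOperator 𝕜 k hk).adjoint.continuous.comp_continuousOn hcont)))).neg

theorem inner_state_sub_of_hasGeneratorAt (hL : 0 < L) (hτ : 0 ≤ τ)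
    (hζ : IsAdjointSolution (generator 𝕜 k hk) τ ζ) {w g : L2R 𝕜}
    (hg : (lineFlow (integralOperator 𝕜 k hk)).HasGeneratorAt w g) :
    ⟪(ζ τ : L2 𝕜 L), state (integralOperator 𝕜 k hk) τ w⟫_𝕜 - ⟪(ζ 0 : L2 𝕜 L), restr 𝕜 L w⟫_𝕜
      = ∫ t in (0 : ℝ)..τ, ⟪controlAdjoint 𝕜 k hk (ζ t), w (L + t)⟫_𝕜 := by
  set K := integralOperator 𝕜 k hk
  have hderiv : ∀ t ∈ Icc 0 τ, HasDerivWithinAt (fun t => ⟪(ζ t : L2 𝕜 L), state K t w⟫_𝕜)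
      (⟪(ζ t : L2 𝕜 L), state K t g⟫_𝕜 + ⟪-(generator 𝕜 k hk)† (ζ t), state K t w⟫_𝕜)
      (Icc 0 τ) t := fun t ht =>
    (hζ.1 t ht).inner 𝕜 ((hasDerivWithinAt_state K hg ht.1).mono Icc_subset_Ici_self)
  have hcont : ContinuousOn (fun t => ⟪(ζ t : L2 𝕜 L), state K t g⟫_𝕜
      + ⟪-(generator 𝕜 k hk)† (ζ t), state K t w⟫_𝕜) (Icc 0 τ) :=
    (ContinuousOn.inner (fun t ht => (hζ.1 t ht).continuousWithinAt)
      (continuous_state K g).continuousOn).add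
      (ContinuousOn.inner hζ.2.neg (continuous_state K w).continuousOn)
  rw [← state_zero K w, ← intervalIntegral.integral_eq_sub_of_hasDerivAt_of_le hτ
    (fun t ht => (hderiv t ht).continuousWithinAt)
    (fun t ht => (hderiv t (Ioo_subset_Icc_self ht)).hasDerivAt (Icc_mem_nhds ht.1 ht.2))
    (hcont.intervalIntegrable_of_Icc hτ)]
  refine intervalIntegral.integral_congr_ae ?_
  filter_upwards [ae_state_eq_smul_one_sub_prim K hg] with t hstate ht
  rw [uIoc_of_le hτ] at ht
  have hgreen := inner_adjoint_smul_one_sub_prim hL (ζ t) (w (L + t))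
    (state K t g - K (state K t w))
  rw [← hstate ht.1.le, sub_add_cancel] at hgreen
  rw [inner_neg_left, hgreen, neg_sub, add_sub_cancel]

/-- By density it suffices to consider data in the domain of the generator of the flow. -/
theorem inner_state_sub (hL : 0 < L) (hτ : 0 ≤ τ)
    (hζ : IsAdjointSolution (generator 𝕜 k hk) τ ζ) (w : L2R 𝕜) :
    ⟪(ζ τ : L2 𝕜 L), state (integralOperator 𝕜 k hk) τ w⟫_𝕜 - ⟪(ζ 0 : L2 𝕜 L), restr 𝕜 L w⟫_𝕜
      = ∫ t in (0 : ℝ)..τ, ⟪controlAdjoint 𝕜 k hk (ζ t), w (L + t)⟫_𝕜 := by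
  have hb := memLp_restrict_Ioo_of_continuousOn (continuousOn_controlAdjoint hL hζ) 2
  have hpair (v : L2R 𝕜) : ∫ t in (0 : ℝ)..τ, ⟪controlAdjoint 𝕜 k hk (ζ t), v (L + t)⟫_𝕜
      = ⟪hb.toLp _, restr 𝕜 τ (shift 𝕜 L v)⟫_𝕜 := by
    rw [intervalIntegral.integral_of_le hτ, integral_Ioc_eq_integral_Ioo, L2.inner_def]
    refine integral_congr_ae ?_
    filter_upwards [hb.coeFn_toLp, coeFn_restr (L := τ) (shift 𝕜 L v),
      ae_restrict_of_ae (coeFn_shift L v)] with t h₁ h₂ h₃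
    rw [h₁, h₂, h₃]
  rw [hpair]
  refine congrFun (Continuous.ext_on
    (lineFlow (integralOperator 𝕜 k hk)).dense_setOf_hasGeneratorAt
    (f := fun v => ⟪(ζ τ : L2 𝕜 L), state (integralOperator 𝕜 k hk) τ v⟫_𝕜
      - ⟪(ζ 0 : L2 𝕜 L), restr 𝕜 L v⟫_𝕜)
    (g := fun v => ⟪hb.toLp _, restr 𝕜 τ (shift 𝕜 L v)⟫_𝕜) (by fun_prop) (by fun_prop) ?_) w
  rintro v ⟨g, hg⟩
  exact (inner_state_sub_of_hasGeneratorAt hL hτ hζ hg).trans (hpair v)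

theorem isTranspositionSolution_state (hL : 0 < L) {T : ℝ} {w : L2R 𝕜} {u : ℝ → 𝕜}
    (hu : restr 𝕜 T (shift 𝕜 L w) =ᵐ[μI T] u) :
    IsTranspositionSolution (generator 𝕜 k hk) (controlAdjoint 𝕜 k hk) T (restr 𝕜 L w) u
      fun t => state (integralOperator 𝕜 k hk) t w := by
  refine ⟨(continuous_state _ w).continuousOn, fun τ hτ ζ hζ => ?_⟩
  rw [inner_state_sub hL hτ.1 hζ w]
  refine intervalIntegral.integral_congr_ae_restrict ?_
  rw [uIoc_of_le hτ.1, ← Measure.restrict_congr_set Ioo_ae_eq_Ioc]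
  filter_upwards [ae_restrict_of_ae_restrict_of_subset (Ioo_subset_Ioo_right hτ.2)
      (hu.symm.trans (coeFn_restr _)), ae_restrict_of_ae (coeFn_shift L w)] with t h₁ h₂
  rw [h₁, h₂]

end Transposition

end IntegralTransport

theorem tendsto_indicatorConstLp_accumulate {α E : Type*} [MeasurableSpace α] {μ : Measure α}
    [IsFiniteMeasure μ] [NormedAddCommGroup E] {p : ℝ≥0∞} [Fact (1 ≤ p)] (hp : p ≠ ⊤)
    {s : ℕ → Set α} (hs : ∀ n, MeasurableSet (s n)) (hacc : ∀ n, MeasurableSet (accumulate s n))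
    (c : E) :
    Tendsto (fun n => indicatorConstLp p (hacc n) (measure_ne_top μ _) c) atTop
      (𝓝 (indicatorConstLp p (.iUnion hs) (measure_ne_top μ _) c)) := by
  refine tendsto_indicatorConstLp_set hp ?_
  have hsub (n : ℕ) : accumulate s n ⊆ ⋃ n, s n := accumulate_subset_iUnion n
  have hdiff (n : ℕ) : μ (symmDiff (accumulate s n) (⋃ n, s n))
      = μ (⋃ n, s n) - μ (accumulate s n) := by
    rw [symmDiff_of_le (hsub n), measure_sdiff (hsub n) (hacc n).nullMeasurableSet
      (measure_ne_top _ _)]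
  simp only [hdiff]
  rw [← tsub_self (μ (⋃ n, s n))]
  exact ENNReal.Tendsto.sub tendsto_const_nhds tendsto_measure_iUnion_accumulate
    (.inl (measure_ne_top _ _))

section IndicatorDense

variable {α 𝕜 : Type*} [RCLike 𝕜] [MeasurableSpace α] {μ : Measure α} [IsFiniteMeasure μ]
  {p : ℝ≥0∞} [Fact (1 ≤ p)] {V : Submodule 𝕜 (Lp 𝕜 p μ)}

theorem indicatorConstLp_mem_of_isPiSystem (hp : p ≠ ⊤) (hV : IsClosed (V : Set (Lp 𝕜 p μ)))
    {C : Set (Set α)} (hC : ‹MeasurableSpace α› = .generateFrom C) (hinter : IsPiSystem C)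
    (huniv : univ ∈ C)
    (h : ∀ s (hs : MeasurableSet s), s ∈ C → indicatorConstLp p hs (measure_ne_top μ s) 1 ∈ V)
    {s : Set α} (hs : MeasurableSet s) : indicatorConstLp p hs (measure_ne_top μ s) 1 ∈ V := by
  induction s, hs using MeasurableSpace.induction_on_inter hC hinter with
  | empty =>
    rw [indicatorConstLp_empty]
    exact V.zero_mem
  | basic s hs => exact h s _ hs
  | compl s hs ih =>
    have hunion := indicatorConstLp_disjoint_union (p := p) hs hs.compl
      (measure_ne_top μ _) (measure_ne_top μ _) disjoint_compl_right (1 : 𝕜)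
    simp only [union_compl_self] at hunion
    exact (V.add_mem_iff_right ih).1 (hunion ▸ h univ .univ huniv)
  | iUnion s hdisj hs ih =>
    have hacc (n : ℕ) : ∃ hn : MeasurableSet (accumulate s n),
        indicatorConstLp p hn (measure_ne_top μ _) 1 ∈ V := by
      induction n with
      | zero => simpa only [accumulate_zero_nat] using ⟨hs 0, ih 0⟩
      | succ n ihn =>
        obtain ⟨hn, hmem⟩ := ihn
        simp only [accumulate_succ]
        refine ⟨hn.union (hs _), ?_⟩
        rw [indicatorConstLp_disjoint_union hn (hs _) (measure_ne_top _ _) (measure_ne_top _ _)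
          (disjoint_accumulate hdisj n.lt_succ_self)]
        exact V.add_mem hmem (ih _)
    choose hacc hmem using hacc
    exact hV.mem_of_tendsto (tendsto_indicatorConstLp_accumulate hp hs hacc 1) (.of_forall hmem)

theorem eq_top_of_forall_indicatorConstLp_mem (hp : p ≠ ⊤) (hV : IsClosed (V : Set (Lp 𝕜 p μ)))
    (h : ∀ s (hs : MeasurableSet s), indicatorConstLp p hs (measure_ne_top μ s) 1 ∈ V) :
    V = ⊤ := by
  refine Submodule.eq_top_iff'.2 (Lp.induction hp _ (fun c s hs _ => ?_)
    (fun _ _ _ _ _ => V.add_mem) hV)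
  have hc : indicatorConstLp p hs (measure_ne_top μ s) c
      = c • indicatorConstLp p hs (measure_ne_top μ s) 1 := by
    rw [indicatorConstLp, indicatorConstLp, ← MemLp.toLp_const_smul]
    congr 1 with x
    rw [Pi.smul_apply, ← indicator_const_smul_apply, smul_eq_mul, mul_one]
  rw [Lp.simpleFunc.coe_indicatorConst, hc]
  exact V.smul_mem c (h s hs)

end IndicatorDense

namespace IntegralTransport

noncomputable section

section Kernel

variable {𝕜 : Type*} [RCLike 𝕜] {L : ℝ} {k g : ℝ × ℝ → ℝ}
  (hk : MemLp k 2 ((μI L).prod (μI L))) (hg : MemLp g 2 ((μI L).prod (μI L)))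

theorem coeFn_integralOperator (y : L2 𝕜 L) :
    integralOperator 𝕜 k hk y =ᵐ[μI L] fun x => ∫ ξ in Ioo 0 L, k (x, ξ) • y ξ :=
  (kernel_memLp hk y).coeFn_toLp

variable {hk hg} in
theorem integralOperator_congr_ae (h : k =ᵐ[(μI L).prod (μI L)] g) :
    integralOperator 𝕜 k hk = integralOperator 𝕜 g hg := by
  ext1 y
  refine Lp.ext ?_
  filter_upwards [coeFn_integralOperator hk y, coeFn_integralOperator hg y,
    Measure.ae_ae_of_ae_prod h] with x hkx hgx hx
  rw [hkx, hgx]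
  exact integral_congr_ae (hx.mono fun ξ hξ => by simp only [hξ])

theorem integralOperator_add :
    integralOperator 𝕜 (k + g) (hk.add hg) = integralOperator 𝕜 k hk + integralOperator 𝕜 g hg := by
  ext1 y
  refine Lp.ext ?_
  filter_upwards [coeFn_integralOperator (hk.add hg) y, coeFn_integralOperator hk y,
    coeFn_integralOperator hg y, Lp.coeFn_add (integralOperator 𝕜 k hk y)
    (integralOperator 𝕜 g hg y), kernel_integrable hk y, kernel_integrable hg y]
    with x hkg hkx hgx hadd hki hgi
  rw [add_apply, hkg, hadd, Pi.add_apply, hkx, hgx, ← integral_add hki hgi]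
  simp only [Pi.add_apply, add_smul]

theorem integralOperator_const_smul (c : ℝ) :
    integralOperator 𝕜 (c • k) (hk.const_smul c) = c • integralOperator 𝕜 k hk := by
  ext1 y
  refine Lp.ext ?_
  filter_upwards [coeFn_integralOperator (hk.const_smul c) y, coeFn_integralOperator hk y,
    Lp.coeFn_smul c (integralOperator 𝕜 k hk y)] with x hck hkx hsmul
  rw [smul_apply, hck, hsmul, Pi.smul_apply, hkx, ← integral_smul]
  simp only [Pi.smul_apply, smul_assoc]

theorem norm_integralOperator_le :
    ‖integralOperator 𝕜 k hk‖ ≤ (eLpNorm k 2 ((μI L).prod (μI L))).toReal :=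
  LinearMap.mkContinuous_norm_le _ ENNReal.toReal_nonneg _

variable (𝕜 L) in
/-- The integral operator as a continuous linear function of its kernel. -/
def kernelOperator : Lp ℝ 2 ((μI L).prod (μI L)) →L[ℝ] L2 𝕜 L →L[𝕜] L2 𝕜 L :=
  LinearMap.mkContinuous
    { toFun := fun F => integralOperator 𝕜 F (Lp.memLp F)
      map_add' := fun F G => by
        rw [← integralOperator_add]
        exact integralOperator_congr_ae (Lp.coeFn_add F G)
      map_smul' := fun c F => by
        rw [RingHom.id_apply, ← integralOperator_const_smul]
        exact integralOperator_congr_ae (Lp.coeFn_smul c F) }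
    1 fun F => (norm_integralOperator_le (Lp.memLp F)).trans_eq (one_mul _).symm

theorem kernelOperator_apply (F : Lp ℝ 2 ((μI L).prod (μI L))) :
    kernelOperator 𝕜 L F = integralOperator 𝕜 F (Lp.memLp F) := rfl

theorem kernelOperator_indicatorConstLp_prod {s t : Set ℝ} (hs : MeasurableSet s)
    (ht : MeasurableSet t) :
    kernelOperator 𝕜 L (indicatorConstLp 2 (hs.prod ht) (measure_ne_top _ _) 1) =
      InnerProductSpace.rankOne 𝕜 (indicatorConstLp 2 hs (measure_ne_top (μI L) _) 1)
        (indicatorConstLp 2 ht (measure_ne_top (μI L) _) 1) := by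
  ext1 y
  rw [kernelOperator_apply, InnerProductSpace.rankOne_apply, L2.inner_indicatorConstLp_one]
  refine Lp.ext ?_
  filter_upwards [coeFn_integralOperator (Lp.memLp _) y,
    Lp.coeFn_smul (∫ ξ in t, y ξ ∂μI L) (indicatorConstLp 2 hs (measure_ne_top (μI L) _) (1 : 𝕜)),
    indicatorConstLp_coeFn (hs := hs) (hμs := measure_ne_top (μI L) _) (p := 2) (c := (1 : 𝕜)),
    Measure.ae_ae_of_ae_prod (indicatorConstLp_coeFn (hs := hs.prod ht)
      (hμs := measure_ne_top ((μI L).prod (μI L)) _) (p := 2) (c := (1 : ℝ)))]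
    with x hK hsmul hsx hx
  rw [hK, hsmul, Pi.smul_apply, hsx, smul_eq_mul, ← integral_indicator ht]
  by_cases hxs : x ∈ s
  · rw [indicator_of_mem hxs, mul_one]
    refine integral_congr_ae (hx.mono fun ξ hξ => ?_)
    by_cases hξt : ξ ∈ t
    · simp only [hξ, indicator_of_mem (mk_mem_prod hxs hξt), one_smul, indicator_of_mem hξt]
    · simp only [hξ, indicator_of_notMem fun h : (x, ξ) ∈ s ×ˢ t => hξt h.2, zero_smul,
        indicator_of_notMem hξt]
  · rw [indicator_of_notMem hxs, mul_zero]
    refine integral_eq_zero_of_ae (hx.mono fun ξ hξ => ?_)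
    simp only [hξ, indicator_of_notMem fun h : (x, ξ) ∈ s ×ˢ t => hxs h.1, zero_smul,
      Pi.zero_apply]

theorem isCompactOperator_integralOperator : IsCompactOperator (integralOperator 𝕜 k hk) := by
  set V := ((compactOperator (RingHom.id 𝕜) (L2 𝕜 L) (L2 𝕜 L)).restrictScalars ℝ).comap
    (kernelOperator 𝕜 L).toLinearMap
  have hV : IsClosed (V : Set (Lp ℝ 2 ((μI L).prod (μI L)))) :=
    isClosed_setOfPred_isCompactOperator.preimage (kernelOperator 𝕜 L).continuous
  have hrect (s : Set (ℝ × ℝ)) (hs : MeasurableSet s)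
      (h : s ∈ image2 (· ×ˢ ·) {s : Set ℝ | MeasurableSet s} {t : Set ℝ | MeasurableSet t}) :
      indicatorConstLp 2 hs (measure_ne_top _ s) 1 ∈ V := by
    obtain ⟨s, hs', t, ht, rfl⟩ := h
    change IsCompactOperator (kernelOperator 𝕜 L _)
    rw [kernelOperator_indicatorConstLp_prod hs' ht]
    exact (isCompactOperator_of_locallyCompactSpace_rng
      (ContinuousLinearMap.toSpanSingleton 𝕜 _)).comp_clm (innerSL 𝕜 _)
  have htop : V = ⊤ := eq_top_of_forall_indicatorConstLp_mem ENNReal.ofNat_ne_top hV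
    fun s hs => indicatorConstLp_mem_of_isPiSystem ENNReal.ofNat_ne_top hV generateFrom_prod.symm
      isPiSystem_prod ⟨univ, mem_ofPred.2 .univ, univ, mem_ofPred.2 .univ, univ_prod_univ⟩ hrect hs
  have hmem : hk.toLp k ∈ V := htop ▸ Submodule.mem_top
  rwa [← integralOperator_congr_ae (hk := Lp.memLp _) hk.coeFn_toLp]

end Kernel

end

end IntegralTransport

theorem ExactlyControllable.approximatelyControllable {𝕜 H U : Type*} [RCLike 𝕜]
    [NormedAddCommGroup H] [InnerProductSpace 𝕜 H] [NormedSpace ℝ H] [CompleteSpace H]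
    [NormedAddCommGroup U] [InnerProductSpace 𝕜 U] {A : H →ₗ.[𝕜] H} {Bs : A†.domain → U} {T : ℝ}
    (h : ExactlyControllable A Bs T) : ApproximatelyControllable A Bs T := fun ε hε y₀ y₁ => by
  obtain ⟨u, hu, y, hy, rfl⟩ := h y₀ y₁
  exact ⟨u, hu, y, hy, by rw [sub_self, norm_zero]; exact hε.le⟩

namespace IntegralTransport

section Controllability

variable {𝕜 : Type*} [RCLike 𝕜] {L T : ℝ} {k : ℝ × ℝ → ℝ} {hk : MemLp k 2 ((μI L).prod (μI L))}

theorem exists_isTranspositionSolution_state (hL : 0 < L) (y₀ : L2 𝕜 L) {u : ℝ → 𝕜}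
    (hu : MemLp u 2 (μI T)) : ∃ v ∈ vanishingOn 𝕜 (Iio L),
      IsTranspositionSolution (generator 𝕜 k hk) (controlAdjoint 𝕜 k hk) T y₀ u
        fun t => state (integralOperator 𝕜 k hk) t (ext 𝕜 L y₀ + v) := by
  have hv : shift 𝕜 (-L) (ext 𝕜 T (hu.toLp u)) ∈ vanishingOn 𝕜 (Iio L) :=
    shift_mem_vanishingOn measurableSet_Ioo.compl (ext_mem_vanishingOn _) fun x hx h => by
      linarith [h.1, mem_Iio.1 hx]
  refine ⟨_, hv, ?_⟩
  have hy₀ : restr 𝕜 L (ext 𝕜 L y₀ + shift 𝕜 (-L) (ext 𝕜 T (hu.toLp u))) = y₀ := by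
    rw [map_add, restr_ext, restr_eq_zero (vanishingOn_anti Ioo_subset_Iio_self hv), add_zero]
  have hzero : restr 𝕜 T (shift 𝕜 L (ext 𝕜 L y₀)) = 0 :=
    restr_eq_zero (shift_mem_vanishingOn measurableSet_Ici (ext_mem_vanishingOn_Ici le_rfl y₀)
      fun x hx => le_add_of_nonneg_right hx.1.le)
  have hsol := isTranspositionSolution_state (hk := hk) (T := T) (u := u) hL
    (w := ext 𝕜 L y₀ + shift 𝕜 (-L) (ext 𝕜 T (hu.toLp u))) (by
      rw [map_add, map_add, hzero, zero_add, shift_shift, add_neg_cancel, shift_zero, restr_ext]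
      exact hu.coeFn_toLp)
  rwa [hy₀] at hsol

theorem exists_isTranspositionSolution_iff (hL : 0 < L) (hT : 0 ≤ T) {y₀ y₁ : L2 𝕜 L} :
    (∃ u : ℝ → 𝕜, MemLp u 2 (μI T) ∧ ∃ y, IsTranspositionSolution (generator 𝕜 k hk)
        (controlAdjoint 𝕜 k hk) T y₀ u y ∧ y T = y₁) ↔
      y₁ - transportSemigroup (integralOperator 𝕜 k hk) T y₀
        ∈ reachable (integralOperator 𝕜 k hk) T := by
  rw [transportSemigroup_apply, mem_reachable]
  constructor
  · rintro ⟨u, hu, y, hy, rfl⟩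
    obtain ⟨v, hv, hsol⟩ := exists_isTranspositionSolution_state (hk := hk) hL y₀ hu
    refine ⟨v, hv, ?_⟩
    have hyT : y T = state (integralOperator 𝕜 k hk) T (ext 𝕜 L y₀ + v) :=
      C0Semigroup.eqOn_of_isTranspositionSolution (A := generator 𝕜 k hk)
        (S := transportSemigroup (integralOperator 𝕜 k hk)) dense_generatorDomain
        (hasGeneratorAt_generator hk hL) hy hsol (right_mem_Icc.2 hT)
    rw [hyT, map_add, add_sub_cancel_left]
  · rintro ⟨v, hv, hvy⟩
    have hrestr : restr 𝕜 L (ext 𝕜 L y₀ + v) = y₀ := by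
      rw [map_add, restr_ext, restr_eq_zero (vanishingOn_anti Ioo_subset_Iio_self hv), add_zero]
    have hsol := isTranspositionSolution_state (hk := hk) (T := T) (w := ext 𝕜 L y₀ + v) hL
      (ae_eq_refl _)
    rw [hrestr] at hsol
    exact ⟨_, Lp.memLp _, _, hsol, by rw [map_add, hvy, add_sub_cancel]⟩

theorem exactlyControllable_iff_reachable_eq_top (hL : 0 < L) (hT : 0 ≤ T) :
    ExactlyControllable (generator 𝕜 k hk) (controlAdjoint 𝕜 k hk) T ↔
      reachable (integralOperator 𝕜 k hk) T = ⊤ := by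
  simp only [ExactlyControllable, exists_isTranspositionSolution_iff hL hT]
  refine ⟨fun h => Submodule.eq_top_iff'.2 fun y => ?_, fun h _ _ => h ▸ Submodule.mem_top⟩
  simpa only [map_zero, sub_zero] using h 0 y

theorem dense_reachable_of_approximatelyControllable (hL : 0 < L) (hT : 0 ≤ T)
    (h : ApproximatelyControllable (generator 𝕜 k hk) (controlAdjoint 𝕜 k hk) T) :
    Dense (reachable (integralOperator 𝕜 k hk) T : Set (L2 𝕜 L)) := by
  refine fun y => Metric.mem_closure_iff.2 fun ε hε => ?_
  obtain ⟨u, hu, x, hx, hxy⟩ := h (ε / 2) (half_pos hε) 0 y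
  have hmem := (exists_isTranspositionSolution_iff hL hT).1 ⟨u, hu, x, hx, rfl⟩
  rw [map_zero, sub_zero] at hmem
  exact ⟨x T, hmem, by rw [dist_comm, dist_eq_norm]; exact hxy.trans_lt (half_lt_self hε)⟩

theorem exactlyControllable_iff_approximatelyControllable (hL : 0 < L) (hT : L ≤ T) :
    ExactlyControllable (generator 𝕜 k hk) (controlAdjoint 𝕜 k hk) T ↔
      ApproximatelyControllable (generator 𝕜 k hk) (controlAdjoint 𝕜 k hk) T := by
  have hT0 := hL.le.trans hT
  refine ⟨fun h => h.approximatelyControllable, fun h => ?_⟩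
  have hclosed := (isClosed_reachable_and_finiteDimensional_orthogonal
    (isCompactOperator_integralOperator (𝕜 := 𝕜) hk) hT0 hT).1
  rw [exactlyControllable_iff_reachable_eq_top hL hT0, ← SetLike.coe_set_eq,
    ← hclosed.closure_eq, Submodule.top_coe]
  exact (dense_reachable_of_approximatelyControllable hL hT0 h).closure_eq

end Controllability

section Fattorini

variable {L T : ℝ} {k : ℝ × ℝ → ℝ} {hk : MemLp k 2 ((μI L).prod (μI L))}

/-- An eigenvector `z` of the adjoint orthogonal to the states reachable in time `t` is orthogonal
to the state reached with the control `s ↦ exp (lam * (t - s)) • z(L)`, which forces `z(L) = 0`. -/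
theorem controlAdjoint_eq_zero_of_mem_reachable_orthogonal (hL : 0 < L) (hT : 0 < T)
    {z : (generator ℂ k hk)†.domain}
    (hzT : (z : L2 ℂ L) ∈ (reachable (integralOperator ℂ k hk) T)ᗮ) {lam : ℂ}
    (hz : (generator ℂ k hk)† z = lam • (z : L2 ℂ L)) : controlAdjoint ℂ k hk z = 0 := by
  have hu : MemLp (fun t : ℝ => Complex.exp (lam * (T - t : ℝ)) • controlAdjoint ℂ k hk z) 2
      (μI T) := memLp_restrict_Ioo_of_continuousOn (by fun_prop) 2
  obtain ⟨v, hv, hsol⟩ := exists_isTranspositionSolution_state hL 0 hu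
  refine eigenvector_controlAdjoint_eq_zero hT (controlAdjoint_smul hL) hz hsol ?_
  rw [map_zero, zero_add]
  exact (Submodule.mem_orthogonal' _ _).1 hzT _ ⟨v, hv, rfl⟩

theorem reachable_eq_top_of_fattoriniCriterion (hL : 0 < L) (hT : L < T)
    (h : FattoriniCriterion (generator ℂ k hk) (controlAdjoint ℂ k hk)) :
    reachable (integralOperator ℂ k hk) T = ⊤ := by
  have hfin {t : ℝ} (ht : L ≤ t) :=
    isClosed_reachable_and_finiteDimensional_orthogonal
      (isCompactOperator_integralOperator (𝕜 := ℂ) hk) (hL.le.trans ht) ht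
  by_contra hne
  have : CompleteSpace (reachable (integralOperator ℂ k hk) T) :=
    (hfin hT.le).1.completeSpace_coe
  obtain ⟨t, ht, z, hzt, hz0, lam, hz⟩ :=
    C0Semigroup.exists_eigenvector_adjoint_of_orthogonal_ne_bot dense_generatorDomain
      (hasGeneratorAt_generator hk hL) hT
      (reachable_mono.mono (Ici_subset_Ici.2 hL.le))
      (fun s hs t ht _ hx => transportSemigroup_apply_mem_reachable hs (hL.le.trans ht) hx)
      (fun t ht => (hfin ht).2) (mt Submodule.orthogonal_eq_bot_iff.1 hne)
  exact hz0 (h lam z hz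
    (controlAdjoint_eq_zero_of_mem_reachable_orthogonal hL (hL.trans_le ht) hzt hz))

theorem reachable_eq_top_iff_fattoriniCriterion (hL : 0 < L) (hT : L < T) :
    reachable (integralOperator ℂ k hk) T = ⊤ ↔
      FattoriniCriterion (generator ℂ k hk) (controlAdjoint ℂ k hk) := by
  have hT0 := (hL.trans hT).le
  refine ⟨fun h => ?_, reachable_eq_top_of_fattoriniCriterion hL hT⟩
  exact ((exactlyControllable_iff_reachable_eq_top hL hT0).2 h).approximatelyControllable
    |>.fattoriniCriterion hT0 (controlAdjoint_smul hL)

end Fattorini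

end IntegralTransport

namespace IntegralTransport

noncomputable section

section ScalarMap

variable {𝕜 𝕜' : Type*} [RCLike 𝕜] [RCLike 𝕜'] (φ : 𝕜 →L[ℝ] 𝕜')

theorem compLpL_mem_vanishingOn {s : Set ℝ} {w : L2R 𝕜} (hw : w ∈ vanishingOn 𝕜 s) :
    φ.compLpL 2 volume w ∈ vanishingOn 𝕜' s := by
  refine mem_vanishingOn_iff.2 ?_
  filter_upwards [ae_restrict_of_ae (φ.coeFn_compLpL w), mem_vanishingOn_iff.1 hw] with x hφ hx
  rw [hφ, hx, Pi.zero_apply, map_zero, Pi.zero_apply]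

theorem compLpL_shift (t : ℝ) (w : L2R 𝕜) :
    φ.compLpL 2 volume (shift 𝕜 t w) = shift 𝕜' t (φ.compLpL 2 volume w) := by
  refine Lp.ext ?_
  filter_upwards [φ.coeFn_compLpL (shift 𝕜 t w), coeFn_shift t w,
    coeFn_shift t (φ.compLpL 2 volume w), (measurePreserving_add_left volume
      t).quasiMeasurePreserving.ae (φ.coeFn_compLpL w)] with x hφ hw hφw hx
  rw [hφ, hw, hφw, hx]

variable {L : ℝ}

theorem compLpL_restr (w : L2R 𝕜) :
    φ.compLpL 2 (μI L) (restr 𝕜 L w) = restr 𝕜' L (φ.compLpL 2 volume w) := by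
  refine Lp.ext ?_
  filter_upwards [φ.coeFn_compLpL (restr 𝕜 L w), coeFn_restr w,
    coeFn_restr (φ.compLpL 2 volume w), ae_restrict_of_ae (φ.coeFn_compLpL w)] with x hφ hw hφw hx
  rw [hφ, hw, hφw, hx]

theorem compLpL_ext (y : L2 𝕜 L) :
    φ.compLpL 2 volume (ext 𝕜 L y) = ext 𝕜' L (φ.compLpL 2 (μI L) y) := by
  refine Lp.ext ?_
  filter_upwards [φ.coeFn_compLpL (ext 𝕜 L y), coeFn_ext y, coeFn_ext (φ.compLpL 2 (μI L) y),
    ae_imp_of_ae_restrict (φ.coeFn_compLpL y)] with x hφ hy hφy hx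
  rw [hφ, hy, hφy]
  by_cases h : x ∈ Ioo 0 L
  · rw [indicator_of_mem h, indicator_of_mem h, hx h]
  · rw [indicator_of_notMem h, indicator_of_notMem h, map_zero]

variable {k : ℝ × ℝ → ℝ} {hk : MemLp k 2 ((μI L).prod (μI L))}

theorem compLpL_integralOperator (y : L2 𝕜 L) :
    φ.compLpL 2 (μI L) (integralOperator 𝕜 k hk y)
      = integralOperator 𝕜' k hk (φ.compLpL 2 (μI L) y) := by
  refine Lp.ext ?_
  filter_upwards [φ.coeFn_compLpL (integralOperator 𝕜 k hk y), coeFn_integralOperator hk y,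
    coeFn_integralOperator hk (φ.compLpL 2 (μI L) y), kernel_integrable hk y] with x hφ hy hφy hint
  rw [hφ, hy, hφy, ← φ.integral_comp_comm hint]
  exact integral_congr_ae ((φ.coeFn_compLpL y).mono fun ξ hξ => by simp only [hξ, map_smul])

theorem compLpL_mem_reachable {t : ℝ} (ht : 0 ≤ t) {y : L2 𝕜 L}
    (hy : y ∈ reachable (integralOperator 𝕜 k hk) t) :
    φ.compLpL 2 (μI L) y ∈ reachable (integralOperator 𝕜' k hk) t := by
  obtain ⟨w, hw, rfl⟩ := mem_reachable.1 hy
  refine mem_reachable.2 ⟨_, compLpL_mem_vanishingOn φ hw, ?_⟩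
  rw [state_apply, state_apply, compLpL_restr, lineFlow, lineFlow,
    ContractionSemigroup.map_perturb_apply (φ.compLpL 2 volume) (compLpL_shift φ) (fun x => ?_) ht]
  simp only [ContinuousLinearMap.comp_apply, compLpL_ext, compLpL_integralOperator, compLpL_restr]

end ScalarMap

section RealParts

open RCLike

variable {𝕜 : Type*} [RCLike 𝕜] {L : ℝ}

theorem reCLM_compLpL_ofRealCLM_compLpL (y : L2 ℝ L) :
    (reCLM (K := 𝕜)).compLpL 2 (μI L) ((ofRealCLM (K := 𝕜)).compLpL 2 (μI L) y) = y := by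
  refine Lp.ext ?_
  filter_upwards [reCLM.coeFn_compLpL ((ofRealCLM (K := 𝕜)).compLpL 2 (μI L) y),
    (ofRealCLM (K := 𝕜)).coeFn_compLpL y] with x hre hofReal
  rw [hre, hofReal, reCLM_apply, ofRealCLM_apply, ofReal_re]

theorem ofRealCLM_compLpL_add_I_smul (z : L2 𝕜 L) :
    (ofRealCLM (K := 𝕜)).compLpL 2 (μI L) (reCLM.compLpL 2 (μI L) z)
      + (I : 𝕜) • (ofRealCLM (K := 𝕜)).compLpL 2 (μI L) (imCLM.compLpL 2 (μI L) z) = z := by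
  set J := (ofRealCLM (K := 𝕜)).compLpL 2 (μI L)
  set a := reCLM.compLpL 2 (μI L) z
  set b := imCLM.compLpL 2 (μI L) z
  refine Lp.ext ?_
  filter_upwards [Lp.coeFn_add (J a) ((I : 𝕜) • J b), Lp.coeFn_smul (I : 𝕜) (J b),
    (ofRealCLM (K := 𝕜)).coeFn_compLpL a, (ofRealCLM (K := 𝕜)).coeFn_compLpL b,
    reCLM.coeFn_compLpL z, imCLM.coeFn_compLpL z] with x hadd hsmul ha hb hre him
  rw [hadd, Pi.add_apply, hsmul, Pi.smul_apply, ha, hb, hre, him, smul_eq_mul, mul_comm]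
  exact re_add_im _

variable {T : ℝ} {k : ℝ × ℝ → ℝ} {hk : MemLp k 2 ((μI L).prod (μI L))}

theorem reachable_eq_top_iff_real (hT : 0 ≤ T) :
    reachable (integralOperator 𝕜 k hk) T = ⊤ ↔ reachable (integralOperator ℝ k hk) T = ⊤ := by
  refine ⟨fun h => Submodule.eq_top_iff'.2 fun y => ?_,
    fun h => Submodule.eq_top_iff'.2 fun z => ?_⟩
  · rw [← reCLM_compLpL_ofRealCLM_compLpL (𝕜 := 𝕜) y]
    exact compLpL_mem_reachable _ hT (h ▸ Submodule.mem_top)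
  · have hreal (y : L2 ℝ L) :
        (ofRealCLM (K := 𝕜)).compLpL 2 (μI L) y ∈ reachable (integralOperator 𝕜 k hk) T :=
      compLpL_mem_reachable _ hT (h ▸ Submodule.mem_top)
    rw [← ofRealCLM_compLpL_add_I_smul z]
    exact add_mem (hreal _) (Submodule.smul_mem _ _ (hreal _))

theorem exactlyControllable_iff_fattoriniCriterion (hL : 0 < L) (hT : L < T) :
    ExactlyControllable (generator 𝕜 k hk) (controlAdjoint 𝕜 k hk) T ↔
      FattoriniCriterion (generator ℂ k hk) (controlAdjoint ℂ k hk) := by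
  have hT0 := (hL.trans hT).le
  rw [exactlyControllable_iff_reachable_eq_top hL hT0, reachable_eq_top_iff_real hT0,
    ← reachable_eq_top_iff_real (𝕜 := ℂ) hT0, reachable_eq_top_iff_fattoriniCriterion hL hT]

end RealParts

end

end IntegralTransport

theorem mainTheorem6_general {𝕜 : Type*} [RCLike 𝕜] {L : ℝ} (hL : 0 < L) {k : ℝ × ℝ → ℝ}
    (hk : MemLp k 2 ((IntegralTransport.μI L).prod (IntegralTransport.μI L))) :
    (∀ T : ℝ, L ≤ T →
      (ExactlyControllable
          (IntegralTransport.generator 𝕜 k hk) (IntegralTransport.controlAdjoint 𝕜 k hk) T ↔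
        ApproximatelyControllable
          (IntegralTransport.generator 𝕜 k hk) (IntegralTransport.controlAdjoint 𝕜 k hk) T)) ∧
    ∀ T : ℝ, L < T →
      (ExactlyControllable
          (IntegralTransport.generator 𝕜 k hk) (IntegralTransport.controlAdjoint 𝕜 k hk) T ↔
        FattoriniCriterion
          (IntegralTransport.generator ℂ k hk) (IntegralTransport.controlAdjoint ℂ k hk)) :=
  ⟨fun _ hT => IntegralTransport.exactlyControllable_iff_approximatelyControllable hL hT,
    fun _ hT => IntegralTransport.exactlyControllable_iff_fattoriniCriterion hL hT⟩

theorem mainTheorem6 (L : ℝ) (hL : 0 < L) (k : ℝ × ℝ → ℝ)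
    (hk : MeasureTheory.MemLp k 2 ((IntegralTransport.μI L).prod (IntegralTransport.μI L))) :
    (ExactlyControllable
        (IntegralTransport.generator ℝ k hk) (IntegralTransport.controlAdjoint ℝ k hk) L ↔
      ApproximatelyControllable
        (IntegralTransport.generator ℝ k hk) (IntegralTransport.controlAdjoint ℝ k hk) L) ∧
    ∀ T : ℝ, L < T →
      (ExactlyControllable
          (IntegralTransport.generator ℝ k hk) (IntegralTransport.controlAdjoint ℝ k hk) T ↔
        FattoriniCriterion
          (IntegralTransport.generator ℂ k hk) (IntegralTransport.controlAdjoint ℂ k hk)) := by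
  exact (mainTheorem6_general hL hk).imp_left fun h => h L le_rfl
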